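/- **Setting.** A ridesharing market consists of a horizon $T\in\mathbb N$, a finite set $\mathcal L$ of locations, travel times $\delta(a,b)\in\mathbb N$ with $\delta(a,b)\ge 1$ and $\delta(a,a)=1$, the set $\mathcal T=\{(a,b,t): a,b\in\mathcal L,\ t\in\mathbb N,\ t+\delta(a,b)\le T\}$ of feasible trips, trip costs $c_{a,b,t}\ge 0$, and costs $\kappa_\Delta\ge 0$ (with $\kappa_0=0$) of exiting $\Delta$ periods before time $T$. There is a finite set $\mathcal D$ of drivers; driver $i$ has type $\theta_i=(s_i,r_i,\tau_i,\bar\tau_i)$, where $s_i\in\{0,1\}$ says whether she has already entered the platform, she is available from location $r_i$ at time $\tau_i\le T$, and she intends to leave at a time $\bar\tau_i>\tau_i$ with $\bar\tau_i\ge T$. There is a finite set $\mathcal R$ of riders; rider $j$ requests one trip $e_j=(o_j,d_j,t_j)\in\mathcal T$, for which she has value $v_j\ge 0$. A feasible path of driver $i$ is a finite, possibly empty sequence of trips in $\mathcal T$, the first starting at $r_i$ at time $\tau_i$ and each later one starting where and when the previous one ends. Let $\mathcal Z_i$ be the (finite) set of these paths. The cost $\lambda_i(Z)$ of $Z\in\mathcal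 Z_i$ is the sum of its trip costs plus $\kappa_{T-t'}$, where $t'$ is the time at which $Z$ ends ($t'=\tau_i$ if $Z$ is empty), except that the empty path costs $0$ if $s_i=0$ (the driver does not enter). A feasible action path of driver $i$ is a path in $\mathcal Z_i$ together with, for each of its trips, either no rider or one rider who requests exactly that trip; its cost is that of the underlying path. A plan with anonymous trip prices $(x,\tilde z,p)$ consists of $x\in\{0,1\}^{\mathcal R}$, a feasible action path $\tilde z_i$ for each driver $i$, and prices $p\in\mathbb R^{\mathcal T}$, such that for every rider $j$ the number of drivers $i$ with rider $j$ on $\tilde z_i$ equals $x_j$. The utility of driver $i$ is $\pi_i=\sum_{j\text{ on }\tilde z_i}p_{e_j}$ minus the cost of $\tilde z_i$. The plan is a competitive equilibrium (CE) if (i) for every rider $j$, $v_j>p_{e_j}$ implies $x_j=1$, and $x_j=1$ implies $v_j\ge p_{e_j}$; and (ii) for every driver $i$, $\pi_i=\max_{Z\in\mathcal Z_i}\bigl\{\sum_{e\in Z}\max\{p_e,0\}-\lambda_i(Z)\bigr\}$. Let $W(\mathcal D,\mathcal R)$ be the highest achievable welfare, i.e. the maximum of $\sum_{j}x_jv_j-\sum_i\sum_{Z\in\mathcal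 Z_i}y_{i,Z}\lambda_i(Z)$ over all real $x_j\in[0,1]$ and $y_{i,Z}\ge 0$ with $\sum_{Z\in\mathcal Z_i}y_{i,Z}=1$ for every driver $i$ and $\sum_{j:\,e_j=e}x_j\le\sum_i\sum_{Z\in\mathcal Z_i:\,e\in Z}y_{i,Z}$ for every $e\in\mathcal T$. For a driver $i$ put $$\Phi_i=W(\mathcal D\cup\{i'\},\mathcal R)-W(\mathcal D,\mathcal R),\qquad \Psi_i=W(\mathcal D,\mathcal R)-W(\mathcal D\setminus\{i\},\mathcal R),$$ where $i'$ is an additional driver with $\theta_{i'}=\theta_i$. **Lemma 4 (Lattice structure).** Let $U\subseteq\mathbb R^{\mathcal D}$ be the set of driver utility profiles $\pi=(\pi_i)_{i\in\mathcal D}$ of all CE plans. Then $U$ is a lattice under the componentwise order: if $\pi,\pi'\in U$, then the profiles $(\max\{\pi_i,\pi'_i\})_i$ and $(\min\{\pi_i,\pi'_i\})_i$ belong to $U$. Moreover $U$ has a least element (the profile of the driver-pessimal CE plans), equal to $(\Phi_i)_{i\in\mathcal D}$, and a greatest element (the profile of the driver-optimal CE plans), equal to $(\Psi_i)_{i\in\mathcal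 D}$. -/

import Mathlib

/-- The primitives of a ridesharing market over a set `L` of locations: horizon `T`, travel times
`dist`, trip costs `cost a b t` and early-exit costs `exitCost Δ` (exiting `Δ` periods before `T`).
Only the values of `cost` at trips that end by time `T` are ever used. -/
structure Market (L : Type*) where
  T : ℕ
  dist : L → L → ℕ
  one_le_dist : ∀ a b, 1 ≤ dist a b
  dist_self : ∀ a, dist a a = 1
  cost : L → L → ℕ → ℝ
  cost_nonneg : ∀ a b t, 0 ≤ cost a b t
  exitCost : ℕ → ℝ
  exitCost_nonneg : ∀ Δ, 0 ≤ exitCost Δ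
  exitCost_zero : exitCost 0 = 0

namespace Market

variable {L : Type*}

/-- A trip `(orig, dest, start)` that ends within the planning horizon. -/
@[ext]
structure Trip (M : Market L) where
  orig : L
  dest : L
  start : ℕ
  end_le : start + M.dist orig dest ≤ M.T

/-- The time at which a trip ends. -/
def Trip.finish {M : Market L} (e : M.Trip) : ℕ := e.start + M.dist e.orig e.dest

/-- The cost of a trip to the driver. -/
def Trip.tripCost {M : Market L} (e : M.Trip) : ℝ := M.cost e.orig e.dest e.start

/-- A driver type: whether the driver has already entered the platform, the location and time of
(possible) entrance, and the intended exit time, which is not before the end of the horizon. -/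
structure DriverType (M : Market L) where
  entered : Bool
  loc : L
  entry : ℕ
  exit : ℕ
  entry_le : entry ≤ M.T
  entry_lt_exit : entry < exit
  horizon_le_exit : M.T ≤ exit

/-- A rider type: the requested trip (within the horizon) and the value for it. -/
structure RiderType (M : Market L) where
  trip : M.Trip
  value : ℝ
  value_nonneg : 0 ≤ value

/-- `M.IsRoute a t l`: the trips in `l` are consecutive, the first one starting at `(a, t)`. -/
def IsRoute (M : Market L) : L → ℕ → List M.Trip → Prop
  | _, _, [] => True
  | a, t, e :: l => e.orig = a ∧ e.start = t ∧ M.IsRoute e.dest e.finish l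

/-- The time at which a route that starts at time `t` ends. -/
def routeEnd (M : Market L) : ℕ → List M.Trip → ℕ
  | t, [] => t
  | _, e :: l => M.routeEnd e.finish l

/-- The feasible paths of a driver. The empty path stands for not entering the platform, or, for a
driver who has already entered, for exiting immediately. -/
def FeasiblePath (M : Market L) (d : M.DriverType) : Type _ :=
  {l : List M.Trip // M.IsRoute d.loc d.entry l}

open Classical in
/-- The cost of a sequence of trips to a driver: the trip costs plus the cost of exiting early;
not entering the platform costs nothing. -/
noncomputable def pathCost (M : Market L) (d : M.DriverType) (l : List M.Trip) : ℝ :=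
  if d.entered = false ∧ l = [] then 0
  else (l.map Trip.tripCost).sum + M.exitCost (M.T - M.routeEnd d.entry l)

theorem IsRoute.start_ge {M : Market L} {a : L} {t : ℕ} {l : List M.Trip}
    (h : M.IsRoute a t l) : ∀ e ∈ l, t ≤ e.start := by
  induction l generalizing a t with
  | nil => simp
  | cons e l ih =>
    obtain ⟨-, h2, h3⟩ := h
    intro f hf
    rcases List.mem_cons.1 hf with rfl | hf
    · exact h2.ge
    · have := ih h3 f hf
      unfold Trip.finish at this
      omega

theorem IsRoute.nodup {M : Market L} {a : L} {t : ℕ} {l : List M.Trip}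
    (h : M.IsRoute a t l) : l.Nodup := by
  induction l generalizing a t with
  | nil => simp
  | cons e l ih =>
    obtain ⟨-, h2, h3⟩ := h
    refine List.nodup_cons.2 ⟨fun he => ?_, ih h3⟩
    have h4 := h3.start_ge e he
    have h5 := M.one_le_dist e.orig e.dest
    unfold Trip.finish at h4
    omega

instance instFiniteTrip [Finite L] (M : Market L) : Finite M.Trip :=
  Finite.of_injective
    (fun e : M.Trip => ((e.orig, e.dest, ⟨e.start, by have := e.end_le; omega⟩) :
      L × L × Fin (M.T + 1)))
    (fun e f h => by
      simp only [Prod.mk.injEq, Fin.mk.injEq] at h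
      exact Trip.ext h.1 h.2.1 h.2.2)

instance instFiniteFeasiblePath [Finite L] (M : Market L) (d : M.DriverType) :
    Finite (M.FeasiblePath d) := by
  classical
  have := Fintype.ofFinite M.Trip
  exact Finite.of_injective
    (fun k : M.FeasiblePath d => (⟨k.1, k.2.nodup⟩ : {l : List M.Trip // l.Nodup}))
    (fun k k' h => Subtype.ext (congrArg (fun x => x.1) h))

noncomputable instance instFintypeFeasiblePath [Finite L] (M : Market L) (d : M.DriverType) :
    Fintype (M.FeasiblePath d) := Fintype.ofFinite _

/-- A feasible action path of a driver: a feasible path, each trip of which is either a relocation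
trip (`none`) or carries a rider `j` who requests this very trip (`some j`). -/
structure ActionPath (M : Market L) {R : Type*} (ρ : R → M.RiderType) (d : M.DriverType) where
  steps : List (M.Trip × Option R)
  isRoute : M.IsRoute d.loc d.entry (steps.map Prod.fst)
  rider_trip : ∀ e j, (e, some j) ∈ steps → e = (ρ j).trip

/-- The driver who follows the action path `z` carries rider `j`. -/
def ActionPath.Serves {M : Market L} {R : Type*} {ρ : R → M.RiderType} {d : M.DriverType}
    (z : M.ActionPath ρ d) (j : R) : Prop :=
  ((ρ j).trip, some j) ∈ z.steps

/-- The cost of an action path, that is, of the path with the same movement in space and time. -/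
noncomputable def ActionPath.actionCost {M : Market L} {R : Type*} {ρ : R → M.RiderType}
    {d : M.DriverType} (z : M.ActionPath ρ d) : ℝ :=
  M.pathCost d (z.steps.map Prod.fst)

/-- A plan with anonymous trip prices: the rider pick-ups `x`, the action paths `z` of the drivers
and the trip prices `price`. -/
structure Plan (M : Market L) {D R : Type*} (θ : D → M.DriverType) (ρ : R → M.RiderType) where
  x : R → ℕ
  z : ∀ i, M.ActionPath ρ (θ i)
  price : M.Trip → ℝ

section Plan

variable {M : Market L} {D R : Type*} {θ : D → M.DriverType} {ρ : R → M.RiderType}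

open Classical in
/-- A rider is picked up exactly if she is on the action path of a driver, and by at most one
driver. -/
def Plan.Feasible [Fintype D] (P : M.Plan θ ρ) : Prop :=
  ∀ j, P.x j = (∑ i, if (P.z i).Serves j then 1 else 0) ∧ P.x j ∈ ({0, 1} : Set ℕ)

open Classical in
/-- The total payment to driver `i`: the prices of the trips on which she carries a rider. -/
noncomputable def Plan.driverPayment [Fintype R] (P : M.Plan θ ρ) (i : D) : ℝ :=
  ∑ j, if (P.z i).Serves j then P.price (ρ j).trip else 0

/-- The utility of driver `i`: her total payment minus her total cost. -/
noncomputable def Plan.utility [Fintype R] (P : M.Plan θ ρ) (i : D) : ℝ :=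
  P.driverPayment i - (P.z i).actionCost

/-- A feasible plan is a competitive equilibrium if riders and drivers best respond to prices. -/
structure Plan.IsCE [Fintype D] [Fintype R] (P : M.Plan θ ρ) : Prop where
  feasible : P.Feasible
  picked_up : ∀ j, P.price (ρ j).trip < (ρ j).value → P.x j = 1
  affordable : ∀ j, P.x j = 1 → P.price (ρ j).trip ≤ (ρ j).value
  driver_best_response : ∀ i, IsGreatest
    (Set.range fun k : M.FeasiblePath (θ i) =>
      (k.1.map fun e => max (P.price e) 0).sum - M.pathCost (θ i) k.1)
    (P.utility i)

end Plan

/-- The set of driver utility profiles of all competitive equilibrium plans. -/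
def ceUtilities (M : Market L) {D R : Type*} [Fintype D] [Fintype R] (θ : D → M.DriverType)
    (ρ : R → M.RiderType) : Set (D → ℝ) :=
  {π | ∃ P : M.Plan θ ρ, P.IsCE ∧ ∀ i, π i = P.utility i}

open Classical in
/-- The constraints of the planning linear program: `x j` is the extent to which rider `j` is
picked up, and `y i k` the extent to which driver `i` takes her feasible path `k`. -/
structure LPFeasible [Finite L] (M : Market L) {D R : Type*} [Fintype D] [Fintype R]
    (θ : D → M.DriverType) (ρ : R → M.RiderType)
    (x : R → ℝ) (y : ∀ i, M.FeasiblePath (θ i) → ℝ) : Prop where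
  capacity : ∀ e : M.Trip, (∑ j, if (ρ j).trip = e then x j else 0) ≤
    ∑ i, ∑ k : M.FeasiblePath (θ i), if e ∈ k.1 then y i k else 0
  one_path : ∀ i, ∑ k : M.FeasiblePath (θ i), y i k = 1
  x_le_one : ∀ j, x j ≤ 1
  x_nonneg : ∀ j, 0 ≤ x j
  y_nonneg : ∀ i k, 0 ≤ y i k

/-- The highest achievable welfare: the optimal objective value of the planning linear program. -/
noncomputable def socialWelfare [Finite L] (M : Market L) {D R : Type*} [Fintype D] [Fintype R]
    (θ : D → M.DriverType) (ρ : R → M.RiderType) : ℝ :=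
  sSup {w | ∃ x y, M.LPFeasible θ ρ x y ∧
    w = ∑ j, x j * (ρ j).value - ∑ i, ∑ k, y i k * M.pathCost (θ i) k.1}

/-- The welfare gain from replicating driver `i`; the drivers are then `Option D`, where `none` is
the replica. -/
noncomputable def replicaGain [Finite L] (M : Market L) {D R : Type*} [Fintype D] [Fintype R]
    (θ : D → M.DriverType) (ρ : R → M.RiderType) (i : D) : ℝ :=
  M.socialWelfare (fun o : Option D => o.elim (θ i) θ) ρ - M.socialWelfare θ ρ

/-- The welfare loss from removing driver `i`. -/
noncomputable def removalLoss [Finite L] (M : Market L) {D R : Type*} [Fintype D] [DecidableEq D]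
    [Fintype R] (θ : D → M.DriverType) (ρ : R → M.RiderType) (i : D) : ℝ :=
  M.socialWelfare θ ρ - M.socialWelfare (fun i' : {i' : D // i' ≠ i} => θ i') ρ

end Market

/-!
The market is a minimum cost flow problem: drivers are units of supply that flow through a
time-expanded network to a sink, and a rider is an edge of capacity one whose cost is reduced by her
value. A potential on the nodes prices the trips and assigns a continuation value to every situation
of a driver. By complementary slackness, the driver utilities of competitive equilibria are exactly
the values at the drivers' nodes of the optimal potentials of the dual problem.

The dual objective is submodular on the lattice of feasible potentials, so the optimal potentials
form a lattice. Adding one unit of supply at `v` adds `φ v` to the dual objective. Hence the change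
of the optimal value bounds `φ v` from below for potentials optimal before the addition, and from
above for those optimal after it. Both bounds are attained, because a step of the successive
shortest path method produces a potential that is optimal before and after.
-/

section Order

theorem isSublattice_setOf_isMinOn_of_submodular {α β : Type*} [Lattice α] [AddCommMonoid β]
    [PartialOrder β] [IsOrderedCancelAddMonoid β] {F : α → β} {s : Set α} (hs : IsSublattice s)
    (hF : ∀ a ∈ s, ∀ b ∈ s, F (a ⊔ b) + F (a ⊓ b) ≤ F a + F b) :
    IsSublattice {a ∈ s | IsMinOn F s a} where
  supClosed a ha b hb := by
    have hinf := hs.infClosed ha.1 hb.1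
    refine ⟨hs.supClosed ha.1 hb.1, fun c hc => (?_ : F (a ⊔ b) ≤ F a).trans (ha.2 hc)⟩
    refine le_of_add_le_add_right (a := F b) (le_trans ?_ (hF a ha.1 b hb.1))
    gcongr
    exact hb.2 hinf
  infClosed a ha b hb := by
    have hsup := hs.supClosed ha.1 hb.1
    refine ⟨hs.infClosed ha.1 hb.1, fun c hc => (?_ : F (a ⊓ b) ≤ F b).trans (hb.2 hc)⟩
    refine le_of_add_le_add_left (a := F a) (le_trans ?_ (hF a ha.1 b hb.1))
    gcongr
    exact ha.2 hsup

section Pi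

variable {ι : Type*} {α : ι → Type*} {S : Set (∀ i, α i)} {m : ∀ i, α i}

theorem isLeast_of_infClosed_of_eval [Finite ι] [∀ i, SemilatticeInf (α i)]
    (hS : InfClosed S) (hne : S.Nonempty) (hm : ∀ i, IsLeast (Function.eval i '' S) (m i)) :
    IsLeast S m := by
  have := Fintype.ofFinite ι
  refine ⟨?_, fun x hx i => (hm i).2 ⟨x, hx, rfl⟩⟩
  rcases isEmpty_or_nonempty ι with hι | hι
  · obtain ⟨x, hx⟩ := hne
    rwa [Subsingleton.elim m x]
  · choose x hxS hxm using fun i => (hm i).1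
    have hmem : Finset.univ.inf' Finset.univ_nonempty x ∈ S :=
      hS.finsetInf'_mem Finset.univ_nonempty fun i _ => hxS i
    have heq : Finset.univ.inf' Finset.univ_nonempty x = m := by
      refine le_antisymm (fun i => ?_) fun i => (hm i).2 ⟨_, hmem, rfl⟩
      rw [← hxm i]
      exact Finset.inf'_le x (Finset.mem_univ i) i
    rwa [← heq]

theorem isGreatest_of_supClosed_of_eval [Finite ι] [∀ i, SemilatticeSup (α i)]
    (hS : SupClosed S) (hne : S.Nonempty) (hm : ∀ i, IsGreatest (Function.eval i '' S) (m i)) :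
    IsGreatest S m :=
  isLeast_of_infClosed_of_eval (α := fun i => (α i)ᵒᵈ) hS hne hm

end Pi

theorem negPart_sup_add_negPart_inf_le (c a b a' b' : ℝ) :
    (c + (a ⊔ a') - (b ⊔ b'))⁻ + (c + (a ⊓ a') - (b ⊓ b'))⁻ ≤ (c + a - b)⁻ + (c + a' - b')⁻ := by
  simp only [negPart_def]
  rcases le_total a a' with h | h <;> rcases le_total b b' with h' | h' <;>
    simp only [h, h', sup_of_le_left, sup_of_le_right, inf_of_le_left, inf_of_le_right] <;>
    grind

theorem exists_nodup_isChain_of_reflTransGen {α : Type*} {r : α → α → Prop} {a b : α}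
    (h : Relation.ReflTransGen r a b) :
    ∃ l : List α, (a :: l).Nodup ∧ (a :: l).IsChain r ∧
      (a :: l).getLast (List.cons_ne_nil a l) = b := by
  induction h using Relation.ReflTransGen.head_induction_on with
  | refl => exact ⟨[], by simp⟩
  | @head a c hac _ ih =>
    obtain ⟨l, hnodup, hchain, hlast⟩ := ih
    by_cases ha : a ∈ c :: l
    · obtain ⟨l₁, l₂, heq⟩ := List.append_of_mem ha
      simp only [heq] at hnodup hchain hlast
      exact ⟨l₂, hnodup.of_append_right, hchain.right_of_append, by simpa using hlast⟩
    · exact ⟨c :: l, List.nodup_cons.2 ⟨ha, hnodup⟩, List.IsChain.cons_cons hac hchain,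
        by simpa using hlast⟩

end Order

/-- A directed multigraph with real arc costs. It serves both as the underlying graph of a flow
network and as the residual graph of a flow. -/
structure CostDigraph (V A : Type*) where
  src : A → V
  tgt : A → V
  cost : A → ℝ

namespace CostDigraph

variable {V A : Type*} (G : CostDigraph V A)

/-- The reduced cost of an arc. With this sign, minus the cheapest cost of reaching a fixed node is
a potential with nonnegative reduced costs. -/
def red (φ : V → ℝ) (a : A) : ℝ :=
  G.cost a + φ (G.src a) - φ (G.tgt a)

/-- There is an arc from `v` to `w`. -/
def Adj (v w : V) : Prop :=
  ∃ a, G.src a = v ∧ G.tgt a = w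

/-- There is an arc of reduced cost zero from `v` to `w`. -/
def Tight (φ : V → ℝ) (v w : V) : Prop :=
  ∃ a, G.src a = v ∧ G.tgt a = w ∧ G.red φ a = 0

/-- The nodes from which `s` can be reached along arcs of reduced cost zero. -/
def tightBasin (φ : V → ℝ) (s : V) : Set V :=
  {v | Relation.ReflTransGen (G.Tight φ) v s}

variable {G} {φ φ' : V → ℝ} {s : V}

theorem red_congr {a : A} (hsrc : φ' (G.src a) = φ (G.src a)) (htgt : φ' (G.tgt a) = φ (G.tgt a)) :
    G.red φ' a = G.red φ a := by
  rw [red, red, hsrc, htgt]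

theorem exists_potential_tight_crossing [Finite A] (hφ : ∀ a, 0 ≤ G.red φ a) {S : Set V}
    (hS : ∃ a, G.src a ∉ S ∧ G.tgt a ∈ S) :
    ∃ φ' : V → ℝ, (∀ a, 0 ≤ G.red φ' a) ∧ Set.EqOn φ' φ S ∧
      ∃ v ∉ S, ∃ w ∈ S, G.Tight φ' v w := by
  classical
  obtain ⟨a₀, ⟨hsrc, htgt⟩, hmin⟩ :=
    Set.exists_min_image {a | G.src a ∉ S ∧ G.tgt a ∈ S} (G.red φ) (Set.toFinite _) hS
  refine ⟨fun v => if v ∈ S then φ v else φ v - G.red φ a₀, fun a => ?_,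
    fun v hv => if_pos hv, G.src a₀, hsrc, G.tgt a₀, htgt, a₀, rfl, rfl, ?_⟩
  · have ha := hφ a
    have ha₀ := hφ a₀
    by_cases h : G.src a ∈ S <;> by_cases h' : G.tgt a ∈ S
    · simpa [red, h, h'] using ha
    · simp only [red, h, h', if_true, if_false] at ha ha₀ ⊢
      linarith
    · have := hmin a ⟨h, h'⟩
      simp only [red, h, h', if_true, if_false] at this ⊢
      linarith
    · simp only [red, h, h', if_false] at ha ⊢
      linarith
  · simp only [red, hsrc, htgt, if_true, if_false]
    ring

theorem tightBasin_subset_of_eqOn (h : Set.EqOn φ' φ (G.tightBasin φ s)) :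
    G.tightBasin φ s ⊆ G.tightBasin φ' s := by
  intro v hv
  induction hv using Relation.ReflTransGen.head_induction_on with
  | refl => exact Relation.ReflTransGen.refl
  | head hvw hw ih =>
    refine ih.head ?_
    have hv := h (Relation.ReflTransGen.head hvw hw)
    obtain ⟨a, rfl, rfl, ha⟩ := hvw
    exact ⟨a, rfl, rfl, (red_congr hv (h hw)).trans ha⟩

theorem exists_crossing_of_reflTransGen {S : Set V} {r : V} (h : Relation.ReflTransGen G.Adj r s)
    (hr : r ∉ S) (hs : s ∈ S) : ∃ a, G.src a ∉ S ∧ G.tgt a ∈ S := by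
  by_contra! hcross
  refine Relation.ReflTransGen.head_induction_on (motive := fun v _ => v ∈ S) h hs ?_ |> hr
  rintro _ _ ⟨a, rfl, rfl⟩ - htgt
  by_contra hsrc
  exact hcross a hsrc htgt

theorem exists_potential_ssubset_tightBasin [Finite A] (hφ : ∀ a, 0 ≤ G.red φ a) {r : V}
    (h : Relation.ReflTransGen G.Adj r s) (hr : r ∉ G.tightBasin φ s) :
    ∃ φ' : V → ℝ, (∀ a, 0 ≤ G.red φ' a) ∧ φ' s = φ s ∧
      G.tightBasin φ s ⊂ G.tightBasin φ' s := by
  have hs : s ∈ G.tightBasin φ s := Relation.ReflTransGen.refl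
  obtain ⟨φ', hφ', heq, v, hv, w, hw, hvw⟩ :=
    exists_potential_tight_crossing hφ (exists_crossing_of_reflTransGen h hr hs)
  have hsub := tightBasin_subset_of_eqOn heq
  exact ⟨φ', hφ', heq hs, hsub, fun hsub' => hv (hsub' ((hsub hw).head hvw))⟩

theorem exists_potential_mem_tightBasin [Finite V] [Finite A] (hφ : ∀ a, 0 ≤ G.red φ a) {r : V}
    (h : Relation.ReflTransGen G.Adj r s) :
    ∃ φ' : V → ℝ, (∀ a, 0 ≤ G.red φ' a) ∧ φ' s = φ s ∧ r ∈ G.tightBasin φ' s := by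
  induction hB : G.tightBasin φ s using WellFoundedGT.induction generalizing φ with
  | ind B ih =>
    by_cases hr : r ∈ G.tightBasin φ s
    · exact ⟨φ, hφ, rfl, hr⟩
    · obtain ⟨φ₁, hφ₁, hs, hlt⟩ := exists_potential_ssubset_tightBasin hφ h hr
      obtain ⟨φ', hφ', hs', hr'⟩ := ih _ (hB ▸ hlt) hφ₁ rfl
      exact ⟨φ', hφ', hs'.trans hs, hr'⟩

end CostDigraph

/-- A flow network with a sink, real edge costs and edge capacities in `ℕ∞`. Supplies are not part
of the network: they are given by a multiset of nodes, one entry for each unit of supply. -/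
structure FlowNetwork (V E : Type*) extends CostDigraph V E where
  sink : V
  cap : E → ℕ∞

namespace FlowNetwork

variable {V E : Type*} (N : FlowNetwork V E)

/-- The residual graph of a flow: an arc `inl e` for each edge `e` with spare capacity, and a
reversed arc `inr e` of opposite cost for each edge `e` that carries flow. -/
def residual (f : E → ℕ) :
    CostDigraph V {a : E ⊕ E // a.elim (fun e => (f e : ℕ∞) < N.cap e) (fun e => 0 < f e)} where
  src a := a.1.elim N.src N.tgt
  tgt a := a.1.elim N.tgt N.src
  cost a := a.1.elim N.cost fun e => -N.cost e

/-- The flow respects the capacities and satisfies complementary slackness with the potential. -/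
structure ComplSlackness (f : E → ℕ) (φ : V → ℝ) : Prop where
  le_cap : ∀ e, (f e : ℕ∞) ≤ N.cap e
  red_nonneg : ∀ e, (f e : ℕ∞) < N.cap e → 0 ≤ N.red φ e
  red_nonpos : ∀ e, 0 < f e → N.red φ e ≤ 0

/-- There is an edge of infinite capacity from `v` to `w`. -/
def UncapAdj (v w : V) : Prop :=
  ∃ e, N.src e = v ∧ N.tgt e = w ∧ N.cap e = ⊤

variable {N} {f : E → ℕ} {φ ψ : V → ℝ}

section Residual

theorem residual_red_inl {e : E} (he : (f e : ℕ∞) < N.cap e) :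
    (N.residual f).red φ ⟨.inl e, he⟩ = N.red φ e := rfl

theorem residual_red_inr {e : E} (he : 0 < f e) :
    (N.residual f).red φ ⟨.inr e, he⟩ = -N.red φ e := by
  simp only [CostDigraph.red, residual, Sum.elim_inr]
  ring

theorem complSlackness_iff_residual :
    N.ComplSlackness f φ ↔
      (∀ e, (f e : ℕ∞) ≤ N.cap e) ∧ ∀ a, 0 ≤ (N.residual f).red φ a := by
  constructor
  · rintro ⟨hcap, hnonneg, hnonpos⟩
    refine ⟨hcap, ?_⟩
    rintro ⟨e | e, he⟩
    · exact (hnonneg e he).trans_eq (residual_red_inl he).symm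
    · rw [residual_red_inr he]
      exact neg_nonneg.2 (hnonpos e he)
  · rintro ⟨hcap, hred⟩
    refine ⟨hcap, fun e he => hred ⟨.inl e, he⟩, fun e he => ?_⟩
    simpa [residual_red_inr he] using hred ⟨.inr e, he⟩

theorem UncapAdj.residual_adj {v w : V} (h : N.UncapAdj v w) (f : E → ℕ) :
    (N.residual f).Adj v w := by
  obtain ⟨e, hsrc, htgt, hcap⟩ := h
  exact ⟨⟨.inl e, show (f e : ℕ∞) < N.cap e from hcap ▸ ENat.natCast_lt_top (f e)⟩, hsrc, htgt⟩

/-- Pushing one unit along a residual arc changes the flow on a single edge `e` to `m`. -/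
theorem exists_update_of_tight (hcap : ∀ e, (f e : ℕ∞) ≤ N.cap e) {v w : V}
    (h : (N.residual f).Tight φ v w) :
    ∃ (e : E) (m : ℕ), N.red φ e = 0 ∧ (m : ℕ∞) ≤ N.cap e ∧ s(N.src e, N.tgt e) = s(v, w) ∧
      ∀ g : V → ℝ, ((m : ℝ) - f e) * (g (N.src e) - g (N.tgt e)) = g v - g w := by
  obtain ⟨⟨e | e, he⟩, rfl, rfl, hred⟩ := h
  · refine ⟨e, f e + 1, hred, ?_, rfl, fun g => ?_⟩
    · exact_mod_cast Order.add_one_le_of_lt he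
    · simp [residual]
  · rw [residual_red_inr he, neg_eq_zero] at hred
    refine ⟨e, f e - 1, hred, le_trans ?_ (hcap e), Sym2.eq_swap, fun g => ?_⟩
    · exact_mod_cast Nat.sub_le _ _
    · simp only [Sum.elim_inr] at he
      simp [residual, Nat.cast_sub he]

end Residual

theorem ComplSlackness.update [DecidableEq E] (h : N.ComplSlackness f φ) {e : E} {m : ℕ}
    (he : N.red φ e = 0) (hm : (m : ℕ∞) ≤ N.cap e) :
    N.ComplSlackness (Function.update f e m) φ where
  le_cap e' := by
    rcases eq_or_ne e' e with rfl | hne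
    · simpa using hm
    · simpa [hne] using h.le_cap e'
  red_nonneg e' he' := by
    rcases eq_or_ne e' e with rfl | hne
    · exact he.ge
    · exact h.red_nonneg e' (by simpa [hne] using he')
  red_nonpos e' he' := by
    rcases eq_or_ne e' e with rfl | hne
    · exact he.le
    · exact h.red_nonpos e' (by simpa [hne] using he')

section Net

variable [Fintype E]

variable (N) in
/-- The net outflow of a flow, as a linear functional on functions of the nodes: the value at the
indicator function of a node is the net outflow there. -/
noncomputable def net (f : E → ℕ) (g : V → ℝ) : ℝ :=
  ∑ e, (f e : ℝ) * (g (N.src e) - g (N.tgt e))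

variable (N) in
/-- The flow ships the units of supply `S` to the sink. Restricting the test functions to those
that vanish at the sink leaves the net outflow there free. -/
def Ships (f : E → ℕ) (S : Multiset V) : Prop :=
  ∀ g : V → ℝ, g N.sink = 0 → N.net f g = (S.map g).sum

theorem net_update [DecidableEq E] (f : E → ℕ) (e : E) (m : ℕ) (g : V → ℝ) :
    N.net (Function.update f e m) g
      = N.net f g + ((m : ℝ) - f e) * (g (N.src e) - g (N.tgt e)) := by
  rw [← sub_eq_iff_eq_add', net, net, ← Finset.sum_sub_distrib, Fintype.sum_eq_single e]
  · rw [Function.update_self, sub_mul]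
  · intro e' he'
    rw [Function.update_of_ne he', sub_self]

theorem ComplSlackness.exists_augmentation_of_isChain (h : N.ComplSlackness f φ) {v : V}
    {l : List V} (hnodup : (v :: l).Nodup) (hchain : (v :: l).IsChain ((N.residual f).Tight φ)) :
    ∃ f', N.ComplSlackness f' φ ∧
      (∀ g, N.net f' g = N.net f g + g v - g ((v :: l).getLast (List.cons_ne_nil v l))) ∧
      ∀ e, (N.src e ∉ v :: l ∨ N.tgt e ∉ v :: l) → f' e = f e := by
  classical
  induction l generalizing v with
  | nil => exact ⟨f, h, by simp, fun _ _ => rfl⟩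
  | cons w l ih =>
    obtain ⟨hv, hnodup'⟩ := List.nodup_cons.1 hnodup
    obtain ⟨hvw, hchain'⟩ := List.isChain_cons_cons.1 hchain
    obtain ⟨f', hslack, hnet, hoff⟩ := ih hnodup' hchain'
    obtain ⟨e, m, hred, hm, hends, hg⟩ := exists_update_of_tight h.le_cap hvw
    have hfe : f' e = f e := hoff e (by grind)
    refine ⟨Function.update f' e m, hslack.update hred hm, fun g => ?_, fun e' he' => ?_⟩
    · rw [net_update, hnet, hfe, hg, List.getLast_cons_cons]
      ring
    · rw [Function.update_of_ne (by grind), hoff e' (by grind)]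

/-- Adjusting the potential first makes a residual path tight, and augmenting along a tight path
preserves complementary slackness. -/
theorem ComplSlackness.exists_augmentation [Finite V] (h : N.ComplSlackness f φ) {v : V}
    (hv : Relation.ReflTransGen N.UncapAdj v N.sink) :
    ∃ φ' f', N.ComplSlackness f φ' ∧ N.ComplSlackness f' φ' ∧ φ' N.sink = φ N.sink ∧
      ∀ g, N.net f' g = N.net f g + g v - g N.sink := by
  obtain ⟨hcap, hred⟩ := complSlackness_iff_residual.1 h
  obtain ⟨φ', hred', hsink, hreach⟩ := CostDigraph.exists_potential_mem_tightBasin hred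
    (Relation.ReflTransGen.mono (fun _ _ h => UncapAdj.residual_adj h f) v N.sink hv)
  have h' := complSlackness_iff_residual.2 ⟨hcap, hred'⟩
  obtain ⟨l, hnodup, hchain, hlast⟩ := exists_nodup_isChain_of_reflTransGen hreach
  obtain ⟨f', hslack, hnet, -⟩ := h'.exists_augmentation_of_isChain hnodup hchain
  exact ⟨φ', f', h', hslack, hsink, hlast ▸ hnet⟩

theorem ComplSlackness.exists_ships_cons [Finite V] (h : N.ComplSlackness f φ)
    {S : Multiset V} (hf : N.Ships f S) {v : V}
    (hv : Relation.ReflTransGen N.UncapAdj v N.sink) :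
    ∃ φ' f', N.ComplSlackness f φ' ∧ N.ComplSlackness f' φ' ∧ φ' N.sink = φ N.sink ∧
      N.Ships f' (v ::ₘ S) := by
  obtain ⟨φ', f', hslack, hslack', hsink, hnet⟩ := h.exists_augmentation hv
  refine ⟨φ', f', hslack, hslack', hsink, fun g hg => ?_⟩
  rw [hnet, hf g hg, hg, Multiset.map_cons, Multiset.sum_cons]
  ring

theorem ComplSlackness.exists_ships [Finite V] (h : N.ComplSlackness 0 φ) (S : Multiset V)
    (hS : ∀ v ∈ S, Relation.ReflTransGen N.UncapAdj v N.sink) :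
    ∃ φ' f, N.ComplSlackness f φ' ∧ φ' N.sink = φ N.sink ∧ N.Ships f S := by
  induction S using Multiset.induction with
  | empty => exact ⟨φ, 0, h, rfl, fun g _ => by simp [net]⟩
  | cons v S ih =>
    obtain ⟨φ₁, f, hslack, hsink, hf⟩ := ih fun w hw => hS w (Multiset.mem_cons_of_mem hw)
    obtain ⟨φ', f', -, hslack', hsink', hf'⟩ :=
      hslack.exists_ships_cons hf (hS v (Multiset.mem_cons_self v S))
    exact ⟨φ', f', hslack', hsink'.trans hsink, hf'⟩

end Net

section Dual

variable (N) in
/-- The feasible potentials of the dual of the minimum cost flow problem: those that vanish at the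
sink and satisfy the dual constraints of the edges of infinite capacity. -/
def potentials : Set (V → ℝ) :=
  {φ | φ N.sink = 0 ∧ ∀ e, N.cap e = ⊤ → 0 ≤ N.red φ e}

theorem ComplSlackness.mem_potentials (h : N.ComplSlackness f φ) (h₀ : φ N.sink = 0) :
    φ ∈ N.potentials :=
  ⟨h₀, fun e he => h.red_nonneg e (he ▸ ENat.natCast_lt_top (f e))⟩

theorem isSublattice_potentials : IsSublattice N.potentials where
  supClosed φ hφ ψ hψ := by
    refine ⟨by simp [hφ.1, hψ.1], fun e he => ?_⟩
    have h₁ := hφ.2 e he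
    have h₂ := hψ.2 e he
    simp only [CostDigraph.red, Pi.sup_apply] at *
    grind
  infClosed φ hφ ψ hψ := by
    refine ⟨by simp [hφ.1, hψ.1], fun e he => ?_⟩
    have h₁ := hφ.2 e he
    have h₂ := hψ.2 e he
    simp only [CostDigraph.red, Pi.inf_apply] at *
    grind

variable (N) in
/-- The contribution of an edge to the duality gap between a flow and a potential. Since
`ENat.toNat ⊤ = 0`, the second term is only present at edges of finite capacity. -/
noncomputable def edgeGap (f : E → ℕ) (φ : V → ℝ) (e : E) : ℝ :=
  f e * N.red φ e + (N.cap e).toNat * (N.red φ e)⁻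

theorem edgeGap_of_cap_eq_coe {e : E} {k : ℕ} (h : N.cap e = k) :
    N.edgeGap f φ e = f e * (N.red φ e)⁺ + (k - f e) * (N.red φ e)⁻ := by
  rw [edgeGap, h, ENat.toNat_natCast]
  nth_rw 1 [← posPart_sub_negPart (N.red φ e)]
  ring

theorem edgeGap_of_cap_eq_top {e : E} (h : N.cap e = ⊤) :
    N.edgeGap f φ e = f e * N.red φ e := by
  simp [edgeGap, h]

theorem edgeGap_nonneg {e : E} (hcap : (f e : ℕ∞) ≤ N.cap e)
    (hφ : N.cap e = ⊤ → 0 ≤ N.red φ e) : 0 ≤ N.edgeGap f φ e := by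
  cases h : N.cap e with
  | top =>
    rw [edgeGap_of_cap_eq_top h]
    exact mul_nonneg (f e).cast_nonneg (hφ h)
  | coe k =>
    have hk : (f e : ℝ) ≤ k := by exact_mod_cast h ▸ hcap
    rw [edgeGap_of_cap_eq_coe h]
    exact add_nonneg (mul_nonneg (f e).cast_nonneg (posPart_nonneg _))
      (mul_nonneg (sub_nonneg.2 hk) (negPart_nonneg _))

theorem edgeGap_eq_zero_iff {e : E} (hcap : (f e : ℕ∞) ≤ N.cap e)
    (hφ : N.cap e = ⊤ → 0 ≤ N.red φ e) :
    N.edgeGap f φ e = 0 ↔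
      ((f e : ℕ∞) < N.cap e → 0 ≤ N.red φ e) ∧ (0 < f e → N.red φ e ≤ 0) := by
  cases h : N.cap e with
  | top =>
    have hred := hφ h
    rw [edgeGap_of_cap_eq_top h, mul_eq_zero, Nat.cast_eq_zero, ← hred.ge_iff_eq',
      Nat.pos_iff_ne_zero, ← or_iff_not_imp_left]
    exact (and_iff_right fun _ => hred).symm
  | coe k =>
    have hk : (f e : ℝ) ≤ k := by exact_mod_cast h ▸ hcap
    rw [edgeGap_of_cap_eq_coe h, add_eq_zero_iff_of_nonneg
        (mul_nonneg (f e).cast_nonneg (posPart_nonneg _))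
        (mul_nonneg (sub_nonneg.2 hk) (negPart_nonneg _)),
      mul_eq_zero, mul_eq_zero, posPart_eq_zero, negPart_eq_zero, sub_eq_zero, and_comm,
      Nat.cast_eq_zero, Nat.cast_inj, Nat.cast_lt, Nat.pos_iff_ne_zero, ← or_iff_not_imp_left]
    have : f e < k ↔ k ≠ f e := by
      have : f e ≤ k := by exact_mod_cast hk
      omega
    rw [this, ← or_iff_not_imp_left]

variable [Fintype E]

theorem complSlackness_iff_sum_edgeGap_eq_zero (hcap : ∀ e, (f e : ℕ∞) ≤ N.cap e)
    (hφ : φ ∈ N.potentials) : N.ComplSlackness f φ ↔ ∑ e, N.edgeGap f φ e = 0 := by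
  rw [Finset.sum_eq_zero_iff_of_nonneg fun e _ => edgeGap_nonneg (hcap e) (hφ.2 e)]
  simp only [Finset.mem_univ, true_imp_iff, fun e => edgeGap_eq_zero_iff (hcap e) (hφ.2 e)]
  exact ⟨fun h e => ⟨h.red_nonneg e, h.red_nonpos e⟩,
    fun h => ⟨hcap, fun e => (h e).1, fun e => (h e).2⟩⟩

variable (N) in
/-- The objective of the dual of the minimum cost flow problem with the units of supply `S`, with
the prices of the finite capacities eliminated; `ENat.toNat ⊤ = 0`. -/
noncomputable def dualValue (S : Multiset V) (φ : V → ℝ) : ℝ :=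
  (S.map φ).sum + ∑ e, (N.cap e).toNat * (N.red φ e)⁻

variable (N) in
/-- The minimizers of the dual objective. -/
def optimalPotentials (S : Multiset V) : Set (V → ℝ) :=
  {φ ∈ N.potentials | IsMinOn (N.dualValue S) N.potentials φ}

variable {S : Multiset V} {v : V}

theorem dualValue_cons : N.dualValue (v ::ₘ S) φ = φ v + N.dualValue S φ := by
  rw [dualValue, dualValue, Multiset.map_cons, Multiset.sum_cons, add_assoc]

theorem dualValue_sup_add_dualValue_inf_le :
    N.dualValue S (φ ⊔ ψ) + N.dualValue S (φ ⊓ ψ) ≤ N.dualValue S φ + N.dualValue S ψ := by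
  have hS : (S.map (φ ⊔ ψ)).sum + (S.map (φ ⊓ ψ)).sum = (S.map φ).sum + (S.map ψ).sum := by
    simp only [← Multiset.sum_map_add, Pi.sup_apply, Pi.inf_apply, max_add_min]
  have hE : ∑ e, ((N.cap e).toNat : ℝ) * (N.red (φ ⊔ ψ) e)⁻
        + ∑ e, ((N.cap e).toNat : ℝ) * (N.red (φ ⊓ ψ) e)⁻
      ≤ ∑ e, ((N.cap e).toNat : ℝ) * (N.red φ e)⁻ + ∑ e, ((N.cap e).toNat : ℝ) * (N.red ψ e)⁻ := by
    simp only [← Finset.sum_add_distrib, ← mul_add]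
    exact Finset.sum_le_sum fun e _ => mul_le_mul_of_nonneg_left
      (negPart_sup_add_negPart_inf_le ..) (Nat.cast_nonneg _)
  simp only [dualValue]
  linarith

theorem isSublattice_optimalPotentials : IsSublattice (N.optimalPotentials S) :=
  isSublattice_setOf_isMinOn_of_submodular isSublattice_potentials fun _ _ _ _ =>
    dualValue_sup_add_dualValue_inf_le

theorem Ships.sum_edgeGap (hf : N.Ships f S) (h₀ : φ N.sink = 0) :
    ∑ e, N.edgeGap f φ e = ∑ e, f e * N.cost e + N.dualValue S φ := by
  rw [dualValue, ← hf φ h₀, net, ← Finset.sum_add_distrib, ← Finset.sum_add_distrib]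
  refine Finset.sum_congr rfl fun e _ => ?_
  rw [edgeGap, CostDigraph.red]
  ring

theorem Ships.neg_cost_le_dualValue (hf : N.Ships f S) (hcap : ∀ e, (f e : ℕ∞) ≤ N.cap e)
    (hφ : φ ∈ N.potentials) : -∑ e, f e * N.cost e ≤ N.dualValue S φ := by
  have := Finset.sum_nonneg fun e (_ : e ∈ Finset.univ) => edgeGap_nonneg (hcap e) (hφ.2 e)
  rw [hf.sum_edgeGap hφ.1] at this
  linarith

theorem ComplSlackness.dualValue_eq (h : N.ComplSlackness f φ) (hf : N.Ships f S)
    (h₀ : φ N.sink = 0) : N.dualValue S φ = -∑ e, f e * N.cost e := by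
  have := (complSlackness_iff_sum_edgeGap_eq_zero h.le_cap (h.mem_potentials h₀)).1 h
  rw [hf.sum_edgeGap h₀] at this
  linarith

theorem ComplSlackness.mem_optimalPotentials (h : N.ComplSlackness f φ) (hf : N.Ships f S)
    (h₀ : φ N.sink = 0) : φ ∈ N.optimalPotentials S :=
  ⟨h.mem_potentials h₀, fun _ hψ =>
    (h.dualValue_eq hf h₀).trans_le (hf.neg_cost_le_dualValue h.le_cap hψ)⟩

theorem ComplSlackness.of_mem_optimalPotentials (h : N.ComplSlackness f φ) (hf : N.Ships f S)
    (h₀ : φ N.sink = 0) (hψ : ψ ∈ N.optimalPotentials S) : N.ComplSlackness f ψ := by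
  rw [complSlackness_iff_sum_edgeGap_eq_zero h.le_cap hψ.1, hf.sum_edgeGap hψ.1.1]
  have h₁ : N.dualValue S ψ ≤ N.dualValue S φ := hψ.2 (h.mem_potentials h₀)
  have h₂ := hf.neg_cost_le_dualValue h.le_cap hψ.1
  linarith [h.dualValue_eq hf h₀]

theorem dualValue_eq_of_mem_optimalPotentials (hφ : φ ∈ N.optimalPotentials S) {w : ℝ}
    (hw : IsLeast (N.dualValue S '' N.potentials) w) : N.dualValue S φ = w := by
  obtain ⟨ψ, hψ, rfl⟩ := hw.1
  exact le_antisymm (hφ.2 hψ) (hw.2 ⟨φ, hφ.1, rfl⟩)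

theorem exists_mem_optimalPotentials_inter [Finite V] {φ₀ : V → ℝ} (h : N.ComplSlackness 0 φ₀)
    (h₀ : φ₀ N.sink = 0) (hS : ∀ w ∈ v ::ₘ S, Relation.ReflTransGen N.UncapAdj w N.sink) :
    (N.optimalPotentials S ∩ N.optimalPotentials (v ::ₘ S)).Nonempty := by
  obtain ⟨φ₁, f, hslack, hsink, hf⟩ :=
    h.exists_ships S fun w hw => hS w (Multiset.mem_cons_of_mem hw)
  obtain ⟨φ, f', hfφ, hf'φ, hsink', hf'⟩ :=
    hslack.exists_ships_cons hf (hS v (Multiset.mem_cons_self v S))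
  have hφ : φ N.sink = 0 := (hsink'.trans hsink).trans h₀
  exact ⟨φ, hfφ.mem_optimalPotentials hf hφ, hf'φ.mem_optimalPotentials hf' hφ⟩

theorem marginal_mem_eval_optimalPotentials_inter
    (hne : (N.optimalPotentials S ∩ N.optimalPotentials (v ::ₘ S)).Nonempty) {w w' : ℝ}
    (hw : IsLeast (N.dualValue S '' N.potentials) w)
    (hw' : IsLeast (N.dualValue (v ::ₘ S) '' N.potentials) w') :
    w' - w ∈ Function.eval v '' (N.optimalPotentials S ∩ N.optimalPotentials (v ::ₘ S)) := by
  obtain ⟨φ, hφ, hφ'⟩ := hne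
  refine ⟨φ, ⟨hφ, hφ'⟩, eq_sub_of_add_eq ?_⟩
  rw [← dualValue_eq_of_mem_optimalPotentials hφ hw,
    ← dualValue_eq_of_mem_optimalPotentials hφ' hw', dualValue_cons]

theorem isLeast_eval_optimalPotentials
    (hne : (N.optimalPotentials S ∩ N.optimalPotentials (v ::ₘ S)).Nonempty) {w w' : ℝ}
    (hw : IsLeast (N.dualValue S '' N.potentials) w)
    (hw' : IsLeast (N.dualValue (v ::ₘ S) '' N.potentials) w') :
    IsLeast (Function.eval v '' N.optimalPotentials S) (w' - w) := by
  refine ⟨Set.image_mono Set.inter_subset_left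
    (marginal_mem_eval_optimalPotentials_inter hne hw hw'), ?_⟩
  rintro _ ⟨φ, hφ, rfl⟩
  have := hw'.2 ⟨φ, hφ.1, dualValue_cons⟩
  rw [dualValue_eq_of_mem_optimalPotentials hφ hw] at this
  exact sub_le_iff_le_add.2 this

theorem isGreatest_eval_optimalPotentials_cons
    (hne : (N.optimalPotentials S ∩ N.optimalPotentials (v ::ₘ S)).Nonempty) {w w' : ℝ}
    (hw : IsLeast (N.dualValue S '' N.potentials) w)
    (hw' : IsLeast (N.dualValue (v ::ₘ S) '' N.potentials) w') :
    IsGreatest (Function.eval v '' N.optimalPotentials (v ::ₘ S)) (w' - w) := by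
  refine ⟨Set.image_mono Set.inter_subset_right
    (marginal_mem_eval_optimalPotentials_inter hne hw hw'), ?_⟩
  rintro _ ⟨φ, hφ, rfl⟩
  have := hw.2 ⟨φ, hφ.1, rfl⟩
  rw [← dualValue_eq_of_mem_optimalPotentials hφ hw', dualValue_cons]
  exact le_sub_iff_add_le.2 (add_le_add_right this _)

end Dual

section Decomposition

variable (N) in
/-- The edges of the list lead consecutively from the node to the sink. -/
def IsPath : V → List E → Prop
  | v, [] => v = N.sink
  | v, e :: p => N.src e = v ∧ IsPath (N.tgt e) p

variable [Fintype E] {S : Multiset V} {v : V}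

theorem Ships.exists_pos_of_src_eq (hf : N.Ships f (v ::ₘ S)) (hv : v ≠ N.sink) :
    ∃ e, N.src e = v ∧ 0 < f e := by
  classical
  by_contra! hcon
  have hnonneg : ∀ w, (0 : ℝ) ≤ Pi.single (M := fun _ => ℝ) v 1 w := fun w =>
    (Pi.single_nonneg.2 zero_le_one : (0 : V → ℝ) ≤ Pi.single v 1) w
  have hnet : N.net f (Pi.single v 1) ≤ 0 := by
    refine Finset.sum_nonpos fun e _ => ?_
    rcases eq_or_ne (N.src e) v with he | he
    · simp [Nat.le_zero.1 (hcon e he)]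
    · rw [Pi.single_eq_of_ne he, zero_sub]
      exact mul_nonpos_of_nonneg_of_nonpos (f e).cast_nonneg (neg_nonpos.2 (hnonneg _))
  rw [hf _ (Pi.single_eq_of_ne hv.symm 1), Multiset.map_cons, Multiset.sum_cons,
    Pi.single_eq_same] at hnet
  have hS : 0 ≤ (S.map (Pi.single v (1 : ℝ))).sum :=
    Multiset.sum_nonneg fun x hx => by
      obtain ⟨w, -, rfl⟩ := Multiset.mem_map.1 hx
      exact hnonneg w
  linarith

theorem Ships.update_pred [DecidableEq E] {e : E} (hf : N.Ships f (N.src e ::ₘ S))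
    (he : 0 < f e) : N.Ships (Function.update f e (f e - 1)) (N.tgt e ::ₘ S) := by
  intro g hg
  rw [net_update, hf g hg, Nat.cast_pred he, Multiset.map_cons, Multiset.map_cons,
    Multiset.sum_cons, Multiset.sum_cons]
  ring

theorem Ships.exists_isPath [DecidableEq E] (hf : N.Ships f (v ::ₘ S)) :
    ∃ p f', N.IsPath v p ∧ (∀ e, f e = f' e + p.count e) ∧ N.Ships f' S := by
  induction hk : ∑ e, f e using Nat.strong_induction_on generalizing f v with
  | _ k ih =>
    rcases eq_or_ne v N.sink with rfl | hv
    · exact ⟨[], f, rfl, by simp, fun g hg => by simpa [hg] using hf g hg⟩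
    · obtain ⟨e, rfl, he⟩ := hf.exists_pos_of_src_eq hv
      have hlt : ∑ e', Function.update f e (f e - 1) e' < k := by
        rw [← hk]
        refine Finset.sum_lt_sum (fun e' _ => ?_) ⟨e, Finset.mem_univ e, by simpa using he⟩
        rcases eq_or_ne e' e with rfl | hne <;> simp [*]
      obtain ⟨p, f', hp, hcount, hf'⟩ := ih _ hlt (hf.update_pred he) rfl
      refine ⟨e :: p, f', ⟨rfl, hp⟩, fun e' => ?_, hf'⟩
      have := hcount e'
      grind [Function.update_apply]

theorem Ships.eq_zero_of_acyclic {height : V → ℝ}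
    (hheight : ∀ e, height (N.src e) < height (N.tgt e)) (hf : N.Ships f 0) : f = 0 := by
  have hnet := hf (fun v => height v - height N.sink) (sub_self _)
  rw [Multiset.map_zero, Multiset.sum_zero, net, Finset.sum_eq_zero_iff_of_nonpos] at hnet
  · funext e
    have hneg : height (N.src e) - height N.sink - (height (N.tgt e) - height N.sink) < 0 := by
      linarith [hheight e]
    exact Nat.cast_eq_zero.1 ((mul_eq_zero.1 (hnet e (Finset.mem_univ e))).resolve_right hneg.ne)
  · intro e _
    exact mul_nonpos_of_nonneg_of_nonpos (f e).cast_nonneg (by linarith [hheight e])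

theorem Ships.exists_isPath_family [DecidableEq E] {height : V → ℝ}
    (hheight : ∀ e, height (N.src e) < height (N.tgt e)) {D : Type*} {n : D → V} {s : Finset D}
    (hf : N.Ships f (s.val.map n)) :
    ∃ P : D → List E, (∀ i ∈ s, N.IsPath (n i) (P i)) ∧ ∀ e, f e = ∑ i ∈ s, (P i).count e := by
  classical
  induction s using Finset.induction_on generalizing f with
  | empty => exact ⟨fun _ => [], by simp, by simp [hf.eq_zero_of_acyclic hheight]⟩
  | insert a s ha ih =>
    rw [Finset.insert_val_of_notMem ha, Multiset.map_cons] at hf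
    obtain ⟨p, f', hp, hcount, hf'⟩ := hf.exists_isPath
    obtain ⟨P, hP, hcountP⟩ := ih hf'
    have hupdate : ∀ i ∈ s, Function.update P a p i = P i := fun i hi =>
      Function.update_of_ne (ne_of_mem_of_not_mem hi ha) _ _
    refine ⟨Function.update P a p, Finset.forall_mem_insert .. |>.2 ⟨?_, fun i hi => ?_⟩,
      fun e => ?_⟩
    · rwa [Function.update_self]
    · rw [hupdate i hi]
      exact hP i hi
    · rw [Finset.sum_insert ha, Function.update_self, hcount, hcountP, add_comm]
      exact congrArg _ (Finset.sum_congr rfl fun i hi => by rw [hupdate i hi])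

end Decomposition

end FlowNetwork

namespace Market

variable {L D R : Type*} {M : Market L}

theorem Trip.start_lt_finish (e : M.Trip) : e.start < e.finish :=
  Nat.lt_add_of_pos_right (M.one_le_dist _ _)

theorem Trip.finish_lt (e : M.Trip) : e.finish < M.T + 1 :=
  Nat.lt_succ_of_le e.end_le

section State

/-- The situation of a driver: whether she has entered the platform, her location, and the time. -/
abbrev State (M : Market L) : Type _ := Bool × L × Fin (M.T + 1)

/-- The state of a driver at the start of a trip. -/
def Trip.origState (e : M.Trip) : M.State :=
  (true, e.orig, ⟨e.start, e.start_lt_finish.trans e.finish_lt⟩)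

/-- The state of a driver at the end of a trip. -/
def Trip.destState (e : M.Trip) : M.State :=
  (true, e.dest, ⟨e.finish, e.finish_lt⟩)

/-- The state of a driver when she becomes available. -/
def DriverType.state (d : M.DriverType) : M.State :=
  (d.entered, d.loc, ⟨d.entry, Nat.lt_succ_of_le d.entry_le⟩)

/-- A driver type who becomes available in the given state. Her intended exit time, which affects
neither her feasible paths nor their costs, is one period after the horizon. -/
def driverAt (M : Market L) (v : M.State) : M.DriverType where
  entered := v.1
  loc := v.2.1
  entry := v.2.2
  exit := M.T + 1
  entry_le := Nat.le_of_lt_succ v.2.2.2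
  entry_lt_exit := v.2.2.2
  horizon_le_exit := Nat.le_succ _

/-- The payoff of a path at the trip prices `q`. -/
noncomputable def pathValue (q : M.Trip → ℝ) (d : M.DriverType) (l : List M.Trip) : ℝ :=
  (l.map q).sum - M.pathCost d l

theorem pathCost_cons (d : M.DriverType) (e : M.Trip) (l : List M.Trip) :
    M.pathCost d (e :: l) = e.tripCost + M.pathCost (M.driverAt e.destState) l := by
  rw [pathCost, if_neg (by simp), pathCost, if_neg (by simp [driverAt, Trip.destState]),
    List.map_cons, List.sum_cons, add_assoc]
  rfl

theorem pathValue_cons (q : M.Trip → ℝ) (d : M.DriverType) (e : M.Trip) (l : List M.Trip) :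
    pathValue q d (e :: l)
      = q e - e.tripCost + pathValue q (M.driverAt e.destState) l := by
  rw [pathValue, pathValue, pathCost_cons, List.map_cons, List.sum_cons]
  ring

theorem pathCost_nil_nonneg (d : M.DriverType) : 0 ≤ M.pathCost d [] := by
  rw [pathCost]
  split_ifs
  · exact le_rfl
  · simpa using M.exitCost_nonneg _

theorem pathCost_not_entered_le (a : L) (t : Fin (M.T + 1)) (l : List M.Trip) :
    M.pathCost (M.driverAt (false, a, t)) l ≤ M.pathCost (M.driverAt (true, a, t)) l := by
  cases l with
  | nil => exact (if_pos ⟨rfl, rfl⟩).trans_le (pathCost_nil_nonneg _)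
  | cons e l => rw [pathCost_cons, pathCost_cons]

end State

section Network

/-- The nodes of the flow network: the states of drivers, and the sink `none`, which stands for
having left the market. -/
abbrev Node (M : Market L) : Type _ := Option M.State

/-- The node at which a driver becomes available. -/
def DriverType.node (d : M.DriverType) : M.Node := some d.state

/-- The edges of the flow network: trips without a rider, the trips of the riders, entering the
platform, and leaving the market; the latter includes never entering the platform. -/
inductive Edge (M : Market L) (R : Type*)
  | trip (e : M.Trip)
  | rider (j : R)
  | enter (a : L) (t : Fin (M.T + 1))
  | exit (v : M.State)

instance instFiniteEdge [Finite L] [Finite R] : Finite (M.Edge R) :=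
  Finite.of_surjective
    (fun s : M.Trip ⊕ R ⊕ (L × Fin (M.T + 1)) ⊕ M.State => match s with
      | .inl e => Edge.trip e
      | .inr (.inl j) => Edge.rider j
      | .inr (.inr (.inl (a, t))) => Edge.enter a t
      | .inr (.inr (.inr v)) => Edge.exit v)
    (fun e => match e with
      | .trip e => ⟨.inl e, rfl⟩
      | .rider j => ⟨.inr (.inl j), rfl⟩
      | .enter a t => ⟨.inr (.inr (.inl (a, t))), rfl⟩
      | .exit v => ⟨.inr (.inr (.inr v)), rfl⟩)

noncomputable instance instFintypeEdge [Finite L] [Finite R] : Fintype (M.Edge R) :=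
  Fintype.ofFinite _

/-- The flow network of a market, in which drivers are units of supply that flow from their nodes
to the sink, and the value of a rider reduces the cost of her trip. -/
noncomputable def network (ρ : R → M.RiderType) : FlowNetwork M.Node (M.Edge R) where
  src
    | .trip e => some e.origState
    | .rider j => some (ρ j).trip.origState
    | .enter a t => some (false, a, t)
    | .exit v => some v
  tgt
    | .trip e => some e.destState
    | .rider j => some (ρ j).trip.destState
    | .enter a t => some (true, a, t)
    | .exit _ => none
  cost
    | .trip e => e.tripCost
    | .rider j => (ρ j).trip.tripCost - (ρ j).value
    | .enter _ _ => 0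
    | .exit v => M.pathCost (M.driverAt v) []
  sink := none
  cap
    | .rider _ => 1
    | _ => ⊤

/-- The supply of the flow network, one unit at the node of each driver. -/
def supply [Fintype D] (θ : D → M.DriverType) : Multiset M.Node :=
  Finset.univ.val.map fun i => (θ i).node

/-- The trip price at which a driver with the given continuation values is indifferent between
taking the trip and her best alternative. -/
def tripPrice (φ : M.Node → ℝ) (e : M.Trip) : ℝ :=
  e.tripCost + φ (some e.origState) - φ (some e.destState)

variable {ρ : R → M.RiderType} {φ : M.Node → ℝ}

theorem red_rider (j : R) :
    (network ρ).red φ (.rider j) = tripPrice φ (ρ j).trip - (ρ j).value := by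
  simp only [CostDigraph.red, network, tripPrice]
  ring

theorem cap_rider (j : R) : (network ρ).cap (.rider j) = 1 := rfl

theorem cap_eq_top_iff (e : M.Edge R) : (network ρ).cap e = ⊤ ↔ ∀ j, e ≠ .rider j := by
  cases e <;> simp [network]

theorem mem_potentials_iff :
    φ ∈ (network ρ).potentials ↔ φ none = 0 ∧ (∀ e, 0 ≤ tripPrice φ e) ∧
      (∀ a t, φ (some (true, a, t)) ≤ φ (some (false, a, t))) ∧
      ∀ v, 0 ≤ M.pathCost (M.driverAt v) [] + φ (some v) := by
  refine and_congr_right fun h₀ => ⟨fun h => ⟨fun e => h (.trip e) rfl, fun a t => ?_, fun v => ?_⟩,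
    fun ⟨htrip, henter, hexit⟩ e he => ?_⟩
  · simpa [CostDigraph.red, network] using h (.enter a t) rfl
  · have h₀ : φ none = 0 := h₀
    simpa [CostDigraph.red, network, h₀] using h (.exit v) rfl
  · have h₀ : φ none = 0 := h₀
    cases e with
    | trip e => exact htrip e
    | rider j => simp [network] at he
    | enter a t => simpa [CostDigraph.red, network] using henter a t
    | exit v => simpa [CostDigraph.red, network, h₀] using hexit v

theorem tripPrice_nonneg (hφ : φ ∈ (network ρ).potentials) (e : M.Trip) : 0 ≤ tripPrice φ e :=
  (mem_potentials_iff.1 hφ).2.1 e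

theorem dualValue_network [Finite L] [Fintype R] (S : Multiset M.Node) :
    (network ρ).dualValue S φ
      = (S.map φ).sum + ∑ j, (tripPrice φ (ρ j).trip - (ρ j).value)⁻ := by
  rw [FlowNetwork.dualValue]
  congr 1
  refine (Fintype.sum_of_injective Edge.rider (fun _ _ h => Edge.rider.inj h) _ _
    (fun e he => ?_) fun j => ?_).symm
  · rw [(cap_eq_top_iff e).2 fun j h => he ⟨j, h.symm⟩]
    simp
  · rw [cap_rider, red_rider]
    simp

theorem sum_map_supply [Fintype D] (θ : D → M.DriverType) (g : M.Node → ℝ) :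
    ((supply θ).map g).sum = ∑ i, g (θ i).node := by
  rw [supply, Multiset.map_map]
  rfl

theorem forall_mem_supply [Fintype D] {θ : D → M.DriverType} {p : M.Node → Prop} :
    (∀ v ∈ supply θ, p v) ↔ ∀ i, p (θ i).node := by
  simp [supply]

theorem supply_replica [Fintype D] (θ : D → M.DriverType) (d : M.DriverType) :
    supply (fun o : Option D => o.elim d θ) = d.node ::ₘ supply θ := by
  rw [supply, univ_option, Finset.insertNone, OrderEmbedding.coe_ofMapLEIff, Finset.cons_val,
    Multiset.map_cons, Finset.map_val, Multiset.map_map]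
  rfl

theorem supply_eq_cons_removal [Fintype D] [DecidableEq D] (θ : D → M.DriverType) (i : D) :
    supply θ = (θ i).node ::ₘ supply fun i' : {i' : D // i' ≠ i} => θ i' := by
  rw [← supply_replica, supply, supply, ← Multiset.map_univ_val_equiv (Equiv.optionSubtypeNe i),
    Multiset.map_map]
  refine Multiset.map_congr rfl fun o _ => ?_
  cases o <;> simp

theorem reflTransGen_uncapAdj_node (d : M.DriverType) :
    Relation.ReflTransGen (network ρ).UncapAdj d.node (network ρ).sink :=
  .single ⟨.exit d.state, rfl, rfl, rfl⟩

end Network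

section HighPotential

variable [Fintype R]

/-- Continuation values so high that no rider is worth serving. -/
noncomputable def highPotential (ρ : R → M.RiderType) : M.Node → ℝ
  | none => 0
  | some (_, _, t) => ((M.T : ℝ) - (t : ℕ)) * ∑ j, (ρ j).value

theorem sum_value_le_tripPrice_highPotential (ρ : R → M.RiderType) (e : M.Trip) :
    ∑ j, (ρ j).value ≤ tripPrice (highPotential ρ) e := by
  have hvalue : 0 ≤ ∑ j, (ρ j).value := Finset.sum_nonneg fun j _ => (ρ j).value_nonneg
  have htime : (e.start : ℝ) + 1 ≤ e.finish := by exact_mod_cast e.start_lt_finish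
  have hcost : 0 ≤ e.tripCost := M.cost_nonneg _ _ _
  simp only [tripPrice, highPotential, Trip.origState, Trip.destState]
  nlinarith

theorem highPotential_mem_potentials (ρ : R → M.RiderType) :
    highPotential ρ ∈ (network ρ).potentials := by
  have hvalue : 0 ≤ ∑ j, (ρ j).value := Finset.sum_nonneg fun j _ => (ρ j).value_nonneg
  refine mem_potentials_iff.2 ⟨rfl,
    fun e => hvalue.trans (sum_value_le_tripPrice_highPotential ρ e), fun a t => le_rfl,
    fun v => add_nonneg (pathCost_nil_nonneg _) (mul_nonneg ?_ hvalue)⟩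
  exact sub_nonneg.2 (Nat.cast_le.2 (Nat.le_of_lt_succ v.2.2.2))

theorem complSlackness_zero_highPotential (ρ : R → M.RiderType) :
    (network ρ).ComplSlackness 0 (highPotential ρ) where
  le_cap e := by simp
  red_nonneg e _ := by
    by_cases he : (network ρ).cap e = ⊤
    · exact (highPotential_mem_potentials ρ).2 e he
    · simp only [cap_eq_top_iff, not_forall, not_not] at he
      obtain ⟨j, rfl⟩ := he
      rw [red_rider, sub_nonneg]
      exact (Finset.single_le_sum (f := fun j => (ρ j).value) (fun j _ => (ρ j).value_nonneg)
        (Finset.mem_univ j)).trans (sum_value_le_tripPrice_highPotential ρ _)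
  red_nonpos e he := absurd he (lt_irrefl 0)

end HighPotential

section WeakDuality

variable {ρ : R → M.RiderType} {φ : M.Node → ℝ}

theorem pathValue_driverAt_le (hφ : φ ∈ (network ρ).potentials) (v : M.State) {l : List M.Trip}
    (hl : M.IsRoute v.2.1 v.2.2 l) : pathValue (tripPrice φ) (M.driverAt v) l ≤ φ (some v) := by
  obtain ⟨-, -, henter, hexit⟩ := mem_potentials_iff.1 hφ
  induction l generalizing v with
  | nil =>
    simp only [pathValue, List.map_nil, List.sum_nil]
    linarith [hexit v]
  | cons e l ih =>
    obtain ⟨s, a, t⟩ := v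
    obtain ⟨rfl, ht, hl⟩ := hl
    obtain rfl : t = e.origState.2.2 := Fin.ext ht.symm
    have horig : φ (some e.origState) ≤ φ (some (s, e.orig, e.origState.2.2)) := by
      cases s
      · exact henter _ _
      · exact le_rfl
    calc pathValue (tripPrice φ) (M.driverAt _) (e :: l)
        = tripPrice φ e - e.tripCost + pathValue (tripPrice φ) (M.driverAt e.destState) l :=
          pathValue_cons _ _ _ _
      _ ≤ tripPrice φ e - e.tripCost + φ (some e.destState) :=
          add_le_add_right (ih e.destState hl) _
      _ = φ (some e.origState) := by rw [tripPrice]; ring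
      _ ≤ _ := horig

theorem pathValue_le_node (hφ : φ ∈ (network ρ).potentials) (d : M.DriverType)
    (k : M.FeasiblePath d) : pathValue (tripPrice φ) d k.1 ≤ φ d.node :=
  pathValue_driverAt_le hφ d.state k.2

theorem sum_map_eq_sum_ite [Fintype M.Trip] [DecidableEq M.Trip] {l : List M.Trip} (hl : l.Nodup)
    (q : M.Trip → ℝ) : (l.map q).sum = ∑ e, if e ∈ l then q e else 0 := by
  rw [← List.sum_toFinset _ hl, ← Finset.sum_filter]
  exact Finset.sum_congr (by ext; simp) fun _ _ => rfl

variable [Finite L] [Fintype D] [Fintype R] {θ : D → M.DriverType}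

theorem LPFeasible.sum_price_le {x : R → ℝ} {y : ∀ i, M.FeasiblePath (θ i) → ℝ}
    (h : M.LPFeasible θ ρ x y) {q : M.Trip → ℝ} (hq : ∀ e, 0 ≤ q e) :
    ∑ j, x j * q (ρ j).trip ≤ ∑ i, ∑ k, y i k * (k.1.map q).sum := by
  classical
  have := Fintype.ofFinite M.Trip
  calc ∑ j, x j * q (ρ j).trip
      = ∑ e, (∑ j, if (ρ j).trip = e then x j else 0) * q e := by
        simp_rw [Finset.sum_mul]
        rw [Finset.sum_comm]
        simp [ite_mul]
    _ ≤ ∑ e : M.Trip, (∑ i, ∑ k : M.FeasiblePath (θ i), if e ∈ k.1 then y i k else 0) * q e :=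
        Finset.sum_le_sum fun e _ => mul_le_mul_of_nonneg_right (h.capacity e) (hq e)
    _ = ∑ i, ∑ k, ∑ e, (if e ∈ k.1 then y i k else 0) * q e := by
        simp_rw [Finset.sum_mul]
        rw [Finset.sum_comm]
        exact Finset.sum_congr rfl fun i _ => Finset.sum_comm
    _ = ∑ i, ∑ k, y i k * (k.1.map q).sum := by
        refine Finset.sum_congr rfl fun i _ => Finset.sum_congr rfl fun k _ => ?_
        simp_rw [sum_map_eq_sum_ite k.2.nodup, Finset.mul_sum, mul_ite, ite_mul, mul_zero, zero_mul]

theorem LPFeasible.sum_pathValue_le {x : R → ℝ} {y : ∀ i, M.FeasiblePath (θ i) → ℝ}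
    (h : M.LPFeasible θ ρ x y) (hφ : φ ∈ (network ρ).potentials) :
    ∑ i, ∑ k, y i k * pathValue (tripPrice φ) (θ i) k.1 ≤ ∑ i, φ (θ i).node :=
  Finset.sum_le_sum fun i _ => calc
    ∑ k, y i k * pathValue (tripPrice φ) (θ i) k.1 ≤ ∑ k, y i k * φ (θ i).node :=
      Finset.sum_le_sum fun k _ =>
        mul_le_mul_of_nonneg_left (pathValue_le_node hφ _ k) (h.y_nonneg i k)
    _ = φ (θ i).node := by rw [← Finset.sum_mul, h.one_path, one_mul]

theorem LPFeasible.sum_mul_value_sub_le {x : R → ℝ} {y : ∀ i, M.FeasiblePath (θ i) → ℝ}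
    (h : M.LPFeasible θ ρ x y) (q : M.Trip → ℝ) :
    ∑ j, x j * ((ρ j).value - q (ρ j).trip) ≤ ∑ j, (q (ρ j).trip - (ρ j).value)⁻ :=
  Finset.sum_le_sum fun j _ => calc
    x j * ((ρ j).value - q (ρ j).trip) ≤ x j * (q (ρ j).trip - (ρ j).value)⁻ :=
      mul_le_mul_of_nonneg_left (by simpa using neg_le_negPart (q (ρ j).trip - (ρ j).value))
        (h.x_nonneg j)
    _ ≤ (q (ρ j).trip - (ρ j).value)⁻ := mul_le_of_le_one_left (negPart_nonneg _) (h.x_le_one j)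

theorem LPFeasible.objective_le_dualValue {x : R → ℝ} {y : ∀ i, M.FeasiblePath (θ i) → ℝ}
    (h : M.LPFeasible θ ρ x y) (hφ : φ ∈ (network ρ).potentials) :
    ∑ j, x j * (ρ j).value - ∑ i, ∑ k, y i k * M.pathCost (θ i) k.1
      ≤ (network ρ).dualValue (supply θ) φ := by
  have hdrivers := h.sum_pathValue_le hφ
  have hriders := h.sum_mul_value_sub_le (tripPrice φ)
  have hprices := h.sum_price_le (tripPrice_nonneg hφ)
  simp only [pathValue, mul_sub, Finset.sum_sub_distrib] at hdrivers hriders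
  rw [dualValue_network, sum_map_supply]
  linarith

theorem bddAbove_objective (θ : D → M.DriverType) (ρ : R → M.RiderType) :
    BddAbove {w | ∃ x y, M.LPFeasible θ ρ x y ∧
      w = ∑ j, x j * (ρ j).value - ∑ i, ∑ k, y i k * M.pathCost (θ i) k.1} := by
  refine ⟨(network ρ).dualValue (supply θ) (highPotential ρ), ?_⟩
  rintro _ ⟨x, y, h, rfl⟩
  exact h.objective_le_dualValue (highPotential_mem_potentials ρ)

theorem sum_feasiblePath_ite [DecidableEq (List M.Trip)] (d : M.DriverType)
    {l : List M.Trip} (hl : M.IsRoute d.loc d.entry l) (g : List M.Trip → ℝ) :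
    ∑ k : M.FeasiblePath d, (if k.1 = l then g k.1 else 0) = g l :=
  (Fintype.sum_eq_single (α := M.FeasiblePath d) ⟨l, hl⟩
    (fun _ hb => if_neg fun h => hb (Subtype.ext h))).trans (if_pos rfl)

theorem lpFeasible_empty_paths [DecidableEq (List M.Trip)]
    (θ : D → M.DriverType) (ρ : R → M.RiderType) :
    M.LPFeasible θ ρ 0 (fun _ k => if k.1 = [] then 1 else 0) where
  capacity e := by
    simp only [Pi.zero_apply, ite_self, Finset.sum_const_zero]
    exact Finset.sum_nonneg fun i _ => Finset.sum_nonneg fun k _ => by positivity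
  one_path i := sum_feasiblePath_ite (θ i) (l := []) trivial fun _ => 1
  x_le_one := by simp
  x_nonneg := by simp
  y_nonneg i k := by positivity

theorem socialWelfare_le_dualValue (hφ : φ ∈ (network ρ).potentials) :
    M.socialWelfare θ ρ ≤ (network ρ).dualValue (supply θ) φ := by
  classical
  refine csSup_le ⟨_, _, _, lpFeasible_empty_paths θ ρ, rfl⟩ ?_
  rintro _ ⟨x, y, h, rfl⟩
  exact h.objective_le_dualValue hφ

end WeakDuality

section PlanWelfare

variable {θ : D → M.DriverType} {ρ : R → M.RiderType} [Fintype D]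

theorem ActionPath.eq_of_serves {d : M.DriverType} (z : M.ActionPath ρ d) {j j' : R}
    (h : z.Serves j) (h' : z.Serves j') (he : (ρ j).trip = (ρ j').trip) : j = j' := by
  have := List.inj_on_of_nodup_map z.isRoute.nodup h h' he
  simpa using (congrArg Prod.snd this)

open Classical in
theorem ActionPath.card_serves_le [Fintype R] {d : M.DriverType} (z : M.ActionPath ρ d)
    (e : M.Trip) : (Finset.univ.filter fun j => (ρ j).trip = e ∧ z.Serves j).card
      ≤ if e ∈ z.steps.map Prod.fst then 1 else 0 := by
  split_ifs with he
  · refine Finset.card_le_one.2 fun j hj j' hj' => ?_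
    simp only [Finset.mem_filter, Finset.mem_univ, true_and] at hj hj'
    exact z.eq_of_serves hj.2 hj'.2 (hj.1.trans hj'.1.symm)
  · refine (Finset.card_eq_zero.2 (Finset.filter_eq_empty_iff.2 ?_)).le
    rintro j - ⟨rfl, hj⟩
    exact he (List.mem_map_of_mem (f := Prod.fst) hj)

open Classical in
theorem Plan.Feasible.lpFeasible [Finite L] [Fintype R] {P : M.Plan θ ρ} (h : P.Feasible) :
    M.LPFeasible θ ρ (fun j => P.x j)
      (fun i k => if k.1 = (P.z i).steps.map Prod.fst then 1 else 0) where
  capacity e := calc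
    (∑ j, if (ρ j).trip = e then (P.x j : ℝ) else 0)
        = ∑ i, ∑ j, if (ρ j).trip = e ∧ (P.z i).Serves j then 1 else 0 := by
      rw [Finset.sum_comm]
      refine Finset.sum_congr rfl fun j _ => ?_
      rw [(h j).1]
      by_cases hj : (ρ j).trip = e <;> simp [hj]
    _ ≤ ∑ i, if e ∈ (P.z i).steps.map Prod.fst then 1 else 0 := by
      refine Finset.sum_le_sum fun i _ => ?_
      rw [Finset.sum_boole]
      exact_mod_cast (P.z i).card_serves_le e
    _ = ∑ i, ∑ k : M.FeasiblePath (θ i), if e ∈ k.1 then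
          (if k.1 = (P.z i).steps.map Prod.fst then 1 else 0) else 0 := by
      refine Finset.sum_congr rfl fun i _ => ?_
      rw [← sum_feasiblePath_ite (θ i) (P.z i).isRoute fun l => if e ∈ l then 1 else 0]
      exact Finset.sum_congr rfl fun k _ => by split_ifs <;> rfl
  one_path i := sum_feasiblePath_ite (θ i) (P.z i).isRoute fun _ => 1
  x_le_one j := by
    rcases (h j).2 with h | h
    · simp [h]
    · simp [Set.mem_singleton_iff.1 h]
  x_nonneg j := by positivity
  y_nonneg i k := by positivity

variable [Fintype R]

theorem Plan.Feasible.welfare_le [Finite L] {P : M.Plan θ ρ} (h : P.Feasible) :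
    ∑ j, (P.x j : ℝ) * (ρ j).value - ∑ i, (P.z i).actionCost ≤ M.socialWelfare θ ρ := by
  classical
  refine le_csSup (bddAbove_objective θ ρ) ⟨_, _, h.lpFeasible, ?_⟩
  simp_rw [ite_mul, one_mul, zero_mul, sum_feasiblePath_ite _ (P.z _).isRoute (M.pathCost _)]
  rfl

theorem Plan.Feasible.sum_driverPayment {P : M.Plan θ ρ} (h : P.Feasible) :
    ∑ i, P.driverPayment i = ∑ j, (P.x j : ℝ) * P.price (ρ j).trip := by
  classical
  unfold Plan.driverPayment
  rw [Finset.sum_comm]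
  refine Finset.sum_congr rfl fun j _ => ?_
  rw [(h j).1, Nat.cast_sum, Finset.sum_mul]
  exact Finset.sum_congr rfl fun i _ => by split_ifs <;> simp

theorem Plan.IsCE.mul_value_sub_price {P : M.Plan θ ρ} (h : P.IsCE) (j : R) :
    (P.x j : ℝ) * ((ρ j).value - P.price (ρ j).trip) = (P.price (ρ j).trip - (ρ j).value)⁻ := by
  rcases (h.feasible j).2 with hx | hx
  · have hprice : (ρ j).value ≤ P.price (ρ j).trip := not_lt.1 fun hlt => by
      simp [h.picked_up j hlt] at hx
    rw [hx, negPart_of_nonneg (sub_nonneg.2 hprice), Nat.cast_zero, zero_mul]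
  · have hx : P.x j = 1 := hx
    rw [hx, negPart_of_nonpos (sub_nonpos.2 (h.affordable j hx)), neg_sub, Nat.cast_one, one_mul]

theorem Plan.IsCE.sum_utility_add_le [Finite L] {P : M.Plan θ ρ} (h : P.IsCE) :
    ∑ i, P.utility i + ∑ j, (P.price (ρ j).trip - (ρ j).value)⁻ ≤ M.socialWelfare θ ρ := by
  refine le_trans (le_of_eq ?_) h.feasible.welfare_le
  simp_rw [← h.mul_value_sub_price, mul_sub, Plan.utility]
  rw [Finset.sum_sub_distrib, Finset.sum_sub_distrib, h.feasible.sum_driverPayment]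
  ring

end PlanWelfare

section ValueFunction

/-- The highest payoff of a driver from each node on at the trip prices `q`. -/
noncomputable def valueFunction (q : M.Trip → ℝ) : M.Node → ℝ
  | none => 0
  | some v => ⨆ k : M.FeasiblePath (M.driverAt v), pathValue q (M.driverAt v) k.1

theorem valueFunction_le {q : M.Trip → ℝ} {v : M.State} {c : ℝ}
    (h : ∀ l, M.IsRoute v.2.1 v.2.2 l → pathValue q (M.driverAt v) l ≤ c) :
    valueFunction q (some v) ≤ c :=
  haveI : Nonempty (M.FeasiblePath (M.driverAt v)) := ⟨⟨[], trivial⟩⟩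
  ciSup_le fun k => h k.1 k.2

variable [Finite L]

theorem pathValue_le_valueFunction (q : M.Trip → ℝ) (v : M.State) {l : List M.Trip}
    (hl : M.IsRoute v.2.1 v.2.2 l) :
    pathValue q (M.driverAt v) l ≤ valueFunction q (some v) :=
  le_ciSup (f := fun k : M.FeasiblePath (M.driverAt v) => pathValue q (M.driverAt v) k.1)
    (Set.finite_range _).bddAbove ⟨l, hl⟩

theorem valueFunction_node {q : M.Trip → ℝ} {d : M.DriverType} {u : ℝ}
    (h : IsGreatest (Set.range fun k : M.FeasiblePath d => pathValue q d k.1) u) :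
    valueFunction q d.node = u := by
  obtain ⟨⟨k, rfl⟩, hu⟩ := h
  exact le_antisymm (valueFunction_le fun l hl => hu ⟨⟨l, hl⟩, rfl⟩)
    (pathValue_le_valueFunction q d.state k.2)

theorem price_le_tripPrice_valueFunction (q : M.Trip → ℝ) (e : M.Trip) :
    q e ≤ tripPrice (valueFunction q) e := by
  suffices h : valueFunction q (some e.destState)
      ≤ e.tripCost + valueFunction q (some e.origState) - q e by
    rw [tripPrice]
    linarith
  refine valueFunction_le fun l hl => ?_
  have hcons := pathValue_le_valueFunction q e.origState (l := e :: l) ⟨rfl, rfl, hl⟩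
  rw [pathValue_cons] at hcons
  linarith

theorem valueFunction_mem_potentials (ρ : R → M.RiderType) {q : M.Trip → ℝ}
    (hq : ∀ e, 0 ≤ q e) : valueFunction q ∈ (network ρ).potentials := by
  refine mem_potentials_iff.2 ⟨rfl, fun e => (hq e).trans (price_le_tripPrice_valueFunction q e),
    fun a t => valueFunction_le fun l hl => ?_, fun v => ?_⟩
  · exact (sub_le_sub_left (pathCost_not_entered_le a t l) _).trans
      (pathValue_le_valueFunction q (false, a, t) hl)
  · have hnil := pathValue_le_valueFunction q v (l := []) trivial
    simp only [pathValue, List.map_nil, List.sum_nil] at hnil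
    linarith

variable [Fintype D] [Fintype R] {θ : D → M.DriverType} {ρ : R → M.RiderType}

theorem Plan.IsCE.exists_mem_optimalPotentials {P : M.Plan θ ρ} (h : P.IsCE) :
    ∃ φ ∈ (network ρ).optimalPotentials (supply θ), ∀ i, P.utility i = φ (θ i).node := by
  set q : M.Trip → ℝ := fun e => max (P.price e) 0
  have hq : valueFunction q ∈ (network ρ).potentials :=
    valueFunction_mem_potentials ρ fun e => le_max_right _ _
  have hu : ∀ i, valueFunction q (θ i).node = P.utility i := fun i =>
    valueFunction_node (h.driver_best_response i)
  refine ⟨valueFunction q, ⟨hq, fun ψ hψ => ?_⟩, fun i => (hu i).symm⟩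
  calc (network ρ).dualValue (supply θ) (valueFunction q)
      = ∑ i, P.utility i + ∑ j, (tripPrice (valueFunction q) (ρ j).trip - (ρ j).value)⁻ := by
        rw [dualValue_network, sum_map_supply, Finset.sum_congr rfl fun i _ => hu i]
    _ ≤ ∑ i, P.utility i + ∑ j, (P.price (ρ j).trip - (ρ j).value)⁻ :=
        add_le_add_right (Finset.sum_le_sum fun j _ => negPart_anti (sub_le_sub_right
          ((le_max_left _ _).trans (price_le_tripPrice_valueFunction q _)) _)) _
    _ ≤ M.socialWelfare θ ρ := h.sum_utility_add_le
    _ ≤ (network ρ).dualValue (supply θ) ψ := socialWelfare_le_dualValue hψ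

end ValueFunction

section PathsToPlans

/-- The step of an action path that an edge of the flow network stands for, if any. -/
def Edge.step (ρ : R → M.RiderType) : M.Edge R → Option (M.Trip × Option R)
  | .trip e => some (e, none)
  | .rider j => some ((ρ j).trip, some j)
  | .enter _ _ => none
  | .exit _ => none

/-- The payment to a driver for a step of an action path at the trip prices `q`. -/
def stepPayment (q : M.Trip → ℝ) : M.Trip × Option R → ℝ
  | (_, none) => 0
  | (e, some _) => q e

variable {ρ : R → M.RiderType} {φ : M.Node → ℝ}

theorem eq_nil_of_isPath_none {p : List (M.Edge R)} (h : (network ρ).IsPath none p) : p = [] := by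
  cases p with
  | nil => rfl
  | cons e p => cases e <;> exact absurd h.1 (Option.some_ne_none _)

theorem isRoute_of_isPath {v : M.State} {p : List (M.Edge R)}
    (h : (network ρ).IsPath (some v) p) :
    M.IsRoute v.2.1 v.2.2 ((p.filterMap (Edge.step ρ)).map Prod.fst) := by
  induction p generalizing v with
  | nil => exact trivial
  | cons e p ih =>
    obtain ⟨hv, hp⟩ := h
    cases e with
    | trip e =>
      obtain rfl : e.origState = v := Option.some.inj hv
      exact ⟨rfl, rfl, ih hp⟩
    | rider j =>
      obtain rfl : (ρ j).trip.origState = v := Option.some.inj hv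
      exact ⟨rfl, rfl, ih hp⟩
    | enter a t =>
      obtain rfl : (false, a, t) = v := Option.some.inj hv
      exact ih (v := (true, a, t)) hp
    | exit w =>
      rw [eq_nil_of_isPath_none hp]
      exact trivial

theorem le_sum_stepPayment_sub_pathCost (h₀ : φ none = 0) {v : M.State} {p : List (M.Edge R)}
    (h : (network ρ).IsPath (some v) p)
    (hred : ∀ e ∈ p, (network ρ).cap e = ⊤ → (network ρ).red φ e ≤ 0) :
    φ (some v) ≤ ((p.filterMap (Edge.step ρ)).map (stepPayment (tripPrice φ))).sum
      - M.pathCost (M.driverAt v) ((p.filterMap (Edge.step ρ)).map Prod.fst) := by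
  induction p generalizing v with
  | nil => exact absurd h (Option.some_ne_none _)
  | cons e p ih =>
    obtain ⟨hv, hp⟩ := h
    have hrest := fun e he => hred e (List.mem_cons_of_mem _ he)
    have he := hred e List.mem_cons_self
    cases e with
    | trip e =>
      obtain rfl : e.origState = v := Option.some.inj hv
      have hprice : tripPrice φ e ≤ 0 := he rfl
      simp only [List.filterMap_cons, Edge.step, List.map_cons, List.sum_cons, stepPayment,
        pathCost_cons]
      rw [tripPrice] at hprice
      linarith [ih hp hrest]
    | rider j =>
      obtain rfl : (ρ j).trip.origState = v := Option.some.inj hv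
      simp only [List.filterMap_cons, Edge.step, List.map_cons, List.sum_cons, stepPayment,
        pathCost_cons]
      rw [tripPrice]
      linarith [ih hp hrest]
    | enter a t =>
      obtain rfl : (false, a, t) = v := Option.some.inj hv
      have henter : φ (some (false, a, t)) ≤ φ (some (true, a, t)) := by
        simpa [CostDigraph.red, network] using he rfl
      exact (henter.trans (ih hp hrest)).trans (sub_le_sub_left (pathCost_not_entered_le a t _) _)
    | exit w =>
      obtain rfl : w = v := Option.some.inj hv
      have hexit : M.pathCost (M.driverAt w) [] + φ (some w) ≤ 0 := by
        simpa [CostDigraph.red, network, h₀] using he rfl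
      rw [eq_nil_of_isPath_none hp]
      simp only [List.filterMap_cons, Edge.step, List.filterMap_nil, List.map_nil,
        List.sum_nil]
      linarith

theorem mem_filterMap_step {p : List (M.Edge R)} {e : M.Trip} {j : R} :
    (e, some j) ∈ p.filterMap (Edge.step ρ) ↔ e = (ρ j).trip ∧ Edge.rider j ∈ p := by
  rw [List.mem_filterMap]
  constructor
  · rintro ⟨e', hp, he'⟩
    cases e' <;> simp only [Edge.step, reduceCtorEq, Option.some.injEq, Prod.mk.injEq,
      and_false] at he'
    obtain ⟨rfl, rfl⟩ := he'
    exact ⟨rfl, hp⟩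
  · rintro ⟨rfl, h⟩
    exact ⟨_, h, rfl⟩

/-- The action path that follows a path of the flow network. -/
def actionPathOfPath {d : M.DriverType} {p : List (M.Edge R)} (h : (network ρ).IsPath d.node p) :
    M.ActionPath ρ d where
  steps := p.filterMap (Edge.step ρ)
  isRoute := isRoute_of_isPath h
  rider_trip _ _ he := (mem_filterMap_step.1 he).1

theorem actionPathOfPath_serves {d : M.DriverType} {p : List (M.Edge R)}
    (h : (network ρ).IsPath d.node p) {j : R} :
    (actionPathOfPath h).Serves j ↔ Edge.rider j ∈ p :=
  mem_filterMap_step.trans (and_iff_right rfl)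

/-- A height of the nodes that increases along all edges of the flow network. -/
def nodeHeight : M.Node → ℝ
  | none => M.T + 2
  | some (s, _, t) => (t : ℕ) + if s then 1 else 0

theorem nodeHeight_lt (e : M.Edge R) :
    nodeHeight ((network ρ).src e) < nodeHeight ((network ρ).tgt e) := by
  cases e with
  | trip e => simpa [network, nodeHeight, Trip.origState, Trip.destState] using e.start_lt_finish
  | rider j =>
    simpa [network, nodeHeight, Trip.origState, Trip.destState] using (ρ j).trip.start_lt_finish
  | enter a t => simp [network, nodeHeight]
  | exit v =>
    have htime : ((v.2.2 : ℕ) : ℝ) ≤ M.T := Nat.cast_le.2 (Nat.le_of_lt_succ v.2.2.2)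
    simp only [network, nodeHeight]
    split_ifs <;> linarith

section Utility

open Classical in
theorem ActionPath.sum_stepPayment [Fintype R] {d : M.DriverType} (z : M.ActionPath ρ d)
    (q : M.Trip → ℝ) :
    (z.steps.map (stepPayment q)).sum = ∑ j, if z.Serves j then q (ρ j).trip else 0 := by
  rw [← List.sum_toFinset _ z.isRoute.nodup.of_map, ← Finset.sum_filter]
  refine (Finset.sum_of_injOn (fun j => ((ρ j).trip, some j)) (fun _ _ _ _ h => ?_)
    (fun j hj => ?_) (fun s hs hne => ?_) fun j _ => rfl).symm
  · simpa using congrArg Prod.snd h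
  · exact List.mem_toFinset.2 (Finset.mem_filter.1 hj).2
  · obtain ⟨e, _ | j⟩ := s
    · rfl
    · obtain rfl := z.rider_trip e j (List.mem_toFinset.1 hs)
      exact absurd ⟨j, Finset.mem_filter.2 ⟨Finset.mem_univ j, List.mem_toFinset.1 hs⟩, rfl⟩ hne

variable [Fintype R] {θ : D → M.DriverType}

theorem Plan.driverPayment_eq_sum_stepPayment (P : M.Plan θ ρ) (i : D) :
    P.driverPayment i = ((P.z i).steps.map (stepPayment P.price)).sum := by
  rw [(P.z i).sum_stepPayment, Plan.driverPayment]

theorem Plan.utility_le_pathValue (P : M.Plan θ ρ) (i : D) :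
    P.utility i
      ≤ pathValue (fun e => max (P.price e) 0) (θ i) ((P.z i).steps.map Prod.fst) := by
  rw [Plan.utility, P.driverPayment_eq_sum_stepPayment, pathValue, List.map_map]
  refine sub_le_sub_right (List.sum_le_sum fun s _ => ?_) _
  obtain ⟨e, _ | j⟩ := s
  · exact le_max_right _ _
  · exact le_max_left _ _

theorem Plan.isCE_of_node_le_utility [Fintype D] {P : M.Plan θ ρ}
    (hφ : φ ∈ (network ρ).potentials) (hfeasible : P.Feasible) (hprice : P.price = tripPrice φ)
    (hpicked : ∀ j, P.price (ρ j).trip < (ρ j).value → P.x j = 1)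
    (hafford : ∀ j, P.x j = 1 → P.price (ρ j).trip ≤ (ρ j).value)
    (hu : ∀ i, φ (θ i).node ≤ P.utility i) : P.IsCE ∧ ∀ i, P.utility i = φ (θ i).node := by
  have hmax : (fun e => max (P.price e) 0) = tripPrice φ := by
    rw [hprice]
    exact funext fun e => max_eq_left (tripPrice_nonneg hφ e)
  have hle := fun i => P.utility_le_pathValue i
  simp only [hmax] at hle
  have hub := fun i (k : M.FeasiblePath (θ i)) => pathValue_le_node hφ (θ i) k
  refine ⟨⟨hfeasible, hpicked, hafford, fun i => ⟨⟨⟨_, (P.z i).isRoute⟩, ?_⟩, ?_⟩⟩,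
    fun i => ((hle i).trans (hub i ⟨_, (P.z i).isRoute⟩)).antisymm (hu i)⟩
  · rw [hmax]
    exact ((hub i ⟨_, (P.z i).isRoute⟩).trans (hu i)).antisymm (hle i)
  · rintro _ ⟨k, rfl⟩
    rw [hmax]
    exact (hub i k).trans (hu i)

end Utility

end PathsToPlans

section FlowsToEquilibria

variable [Finite L] [Fintype D] {θ : D → M.DriverType} {ρ : R → M.RiderType}
  {f : M.Edge R → ℕ} {φ : M.Node → ℝ}

open Classical in
theorem exists_plan_of_flow [Finite R] (hf : (network ρ).Ships f (supply θ))
    (hcap : ∀ e, (f e : ℕ∞) ≤ (network ρ).cap e) (q : M.Trip → ℝ) :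
    ∃ P : M.Plan θ ρ, P.Feasible ∧ P.price = q ∧ (∀ j, P.x j = f (.rider j)) ∧
      ∀ i, ∃ p : List (M.Edge R), (∀ e ∈ p, 0 < f e) ∧ (network ρ).IsPath (θ i).node p ∧
        (P.z i).steps = p.filterMap (Edge.step ρ) := by
  obtain ⟨p, hp, hcount⟩ := FlowNetwork.Ships.exists_isPath_family nodeHeight_lt hf
  replace hp : ∀ i, (network ρ).IsPath (θ i).node (p i) := fun i => hp i (Finset.mem_univ i)
  have hle : ∀ i e, (p i).count e ≤ f e := fun i e => by
    rw [hcount e]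
    exact Finset.single_le_sum (f := fun i => (p i).count e) (fun _ _ => Nat.zero_le _)
      (Finset.mem_univ i)
  have hone : ∀ j, f (.rider j) ≤ 1 := fun j => Nat.cast_le_one.1 (hcap (.rider j))
  refine ⟨⟨fun j => f (.rider j), fun i => actionPathOfPath (hp i), q⟩,
    fun j => ⟨?_, Nat.le_one_iff_eq_zero_or_eq_one.1 (hone j)⟩, rfl, fun _ => rfl,
    fun i => ⟨p i, fun e he => (List.count_pos_iff.2 he).trans_le (hle i e), hp i, rfl⟩⟩
  refine (hcount (.rider j)).trans (Finset.sum_congr rfl fun i _ => ?_)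
  simp only [actionPathOfPath_serves]
  split_ifs with hj
  · exact ((hle i _).trans (hone j)).antisymm (List.count_pos_iff.2 hj)
  · exact List.count_eq_zero.2 hj

variable (θ ρ) in
theorem exists_complSlackness_ships [Finite R] :
    ∃ φ f, (network ρ).ComplSlackness f φ ∧ φ none = 0 ∧ (network ρ).Ships f (supply θ) := by
  have := Fintype.ofFinite R
  obtain ⟨φ, f, h, hsink, hf⟩ := (complSlackness_zero_highPotential ρ).exists_ships (supply θ)
    (forall_mem_supply.2 fun i => reflTransGen_uncapAdj_node (θ i))
  exact ⟨φ, f, h, hsink, hf⟩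

variable (θ ρ) in
theorem optimalPotentials_inter_cons_nonempty [Finite R] (d : M.DriverType) :
    ((network ρ).optimalPotentials (supply θ) ∩
      (network ρ).optimalPotentials (d.node ::ₘ supply θ)).Nonempty := by
  have := Fintype.ofFinite R
  refine FlowNetwork.exists_mem_optimalPotentials_inter (complSlackness_zero_highPotential ρ) rfl ?_
  exact Multiset.forall_mem_cons.2 ⟨reflTransGen_uncapAdj_node d,
    forall_mem_supply.2 fun i => reflTransGen_uncapAdj_node (θ i)⟩

theorem exists_isCE_of_complSlackness [Fintype R]
    (h : (network ρ).ComplSlackness f φ) (h₀ : φ none = 0) (hf : (network ρ).Ships f (supply θ)) :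
    ∃ P : M.Plan θ ρ, P.IsCE ∧ P.price = tripPrice φ ∧ ∀ i, P.utility i = φ (θ i).node := by
  obtain ⟨P, hfeasible, hprice, hx, hz⟩ := exists_plan_of_flow hf h.le_cap (tripPrice φ)
  have hpicked : ∀ j, P.price (ρ j).trip < (ρ j).value → P.x j = 1 := fun j hj => by
    refine (hfeasible j).2.resolve_left fun hx₀ => hj.not_ge ?_
    have hred := h.red_nonneg (.rider j) (by simp [cap_rider, ← hx, hx₀])
    rwa [red_rider, sub_nonneg, ← hprice] at hred
  have hafford : ∀ j, P.x j = 1 → P.price (ρ j).trip ≤ (ρ j).value := fun j hj => by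
    have hred := h.red_nonpos (.rider j) (by simp [← hx, hj])
    rwa [red_rider, sub_nonpos, ← hprice] at hred
  have hu : ∀ i, φ (θ i).node ≤ P.utility i := fun i => by
    obtain ⟨p, hpos, hp, hsteps⟩ := hz i
    rw [Plan.utility, P.driverPayment_eq_sum_stepPayment, ActionPath.actionCost, hprice, hsteps]
    exact le_sum_stepPayment_sub_pathCost h₀ hp fun e he _ => h.red_nonpos e (hpos e he)
  obtain ⟨hCE, hutility⟩ :=
    Plan.isCE_of_node_le_utility (h.mem_potentials h₀) hfeasible hprice hpicked hafford hu
  exact ⟨P, hCE, hprice, hutility⟩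

end FlowsToEquilibria

section StrongDuality

variable [Finite L] [Fintype D] [Fintype R] {θ : D → M.DriverType} {ρ : R → M.RiderType}

theorem ceUtilities_eq_image_optimalPotentials (θ : D → M.DriverType) (ρ : R → M.RiderType) :
    M.ceUtilities θ ρ
      = (fun φ i => φ (θ i).node) '' (network ρ).optimalPotentials (supply θ) := by
  ext π
  constructor
  · rintro ⟨P, hP, hu⟩
    obtain ⟨φ, hφ, hPφ⟩ := hP.exists_mem_optimalPotentials
    exact ⟨φ, hφ, funext fun i => ((hu i).trans (hPφ i)).symm⟩
  · rintro ⟨ψ, hψ, rfl⟩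
    obtain ⟨φ, f, h, h₀, hf⟩ := exists_complSlackness_ships θ ρ
    obtain ⟨P, hP, -, hu⟩ :=
      exists_isCE_of_complSlackness (h.of_mem_optimalPotentials hf h₀ hψ) hψ.1.1 hf
    exact ⟨P, hP, fun i => (hu i).symm⟩

theorem isLeast_socialWelfare (θ : D → M.DriverType) (ρ : R → M.RiderType) :
    IsLeast ((network ρ).dualValue (supply θ) '' (network ρ).potentials)
      (M.socialWelfare θ ρ) := by
  refine ⟨?_, Set.forall_mem_image.2 fun φ hφ => socialWelfare_le_dualValue hφ⟩
  obtain ⟨φ, f, h, h₀, hf⟩ := exists_complSlackness_ships θ ρ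
  refine ⟨φ, h.mem_potentials h₀, le_antisymm ?_ (socialWelfare_le_dualValue (h.mem_potentials h₀))⟩
  obtain ⟨P, hP, hprice, hu⟩ := exists_isCE_of_complSlackness h h₀ hf
  simpa only [hprice, hu, dualValue_network, sum_map_supply] using hP.sum_utility_add_le

end StrongDuality

section Lattice

variable [Finite L] [Fintype D] [Fintype R] (θ : D → M.DriverType) (ρ : R → M.RiderType)

theorem isSublattice_ceUtilities : IsSublattice (M.ceUtilities θ ρ) := by
  rw [ceUtilities_eq_image_optimalPotentials]
  exact FlowNetwork.isSublattice_optimalPotentials.image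
    (⟨⟨fun φ i => φ (θ i).node, fun _ _ => rfl⟩, fun _ _ => rfl⟩ :
      LatticeHom (M.Node → ℝ) (D → ℝ))

theorem ceUtilities_nonempty : (M.ceUtilities θ ρ).Nonempty := by
  obtain ⟨φ, f, h, h₀, hf⟩ := exists_complSlackness_ships θ ρ
  rw [ceUtilities_eq_image_optimalPotentials]
  exact ⟨_, φ, h.mem_optimalPotentials hf h₀, rfl⟩

theorem image_eval_ceUtilities (i : D) : Function.eval i '' M.ceUtilities θ ρ
    = Function.eval (θ i).node '' (network ρ).optimalPotentials (supply θ) := by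
  rw [ceUtilities_eq_image_optimalPotentials, Set.image_image]

theorem isLeast_replicaGain : IsLeast (M.ceUtilities θ ρ) (M.replicaGain θ ρ) := by
  refine isLeast_of_infClosed_of_eval (isSublattice_ceUtilities θ ρ).infClosed
    (ceUtilities_nonempty θ ρ) fun i => ?_
  have hreplica := isLeast_socialWelfare (fun o : Option D => o.elim (θ i) θ) ρ
  rw [supply_replica] at hreplica
  rw [image_eval_ceUtilities]
  exact FlowNetwork.isLeast_eval_optimalPotentials
    (optimalPotentials_inter_cons_nonempty θ ρ (θ i)) (isLeast_socialWelfare θ ρ) hreplica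

theorem isGreatest_removalLoss [DecidableEq D] :
    IsGreatest (M.ceUtilities θ ρ) (M.removalLoss θ ρ) := by
  refine isGreatest_of_supClosed_of_eval (isSublattice_ceUtilities θ ρ).supClosed
    (ceUtilities_nonempty θ ρ) fun i => ?_
  have hmarket := isLeast_socialWelfare θ ρ
  rw [supply_eq_cons_removal θ i] at hmarket
  rw [image_eval_ceUtilities, supply_eq_cons_removal θ i]
  exact FlowNetwork.isGreatest_eval_optimalPotentials_cons
    (optimalPotentials_inter_cons_nonempty _ ρ (θ i)) (isLeast_socialWelfare _ ρ) hmarket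

end Lattice

end Market

theorem lemma4 {L D R : Type*} [Finite L] [Fintype D] [DecidableEq D] [Fintype R]
    (M : Market L) (θ : D → M.DriverType) (ρ : R → M.RiderType) :
    (∀ π ∈ M.ceUtilities θ ρ, ∀ π' ∈ M.ceUtilities θ ρ,
      (fun i => max (π i) (π' i)) ∈ M.ceUtilities θ ρ ∧
      (fun i => min (π i) (π' i)) ∈ M.ceUtilities θ ρ) ∧
    IsLeast (M.ceUtilities θ ρ) (M.replicaGain θ ρ) ∧
    IsGreatest (M.ceUtilities θ ρ) (M.removalLoss θ ρ) := by
  have hlattice := M.isSublattice_ceUtilities θ ρ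
  exact ⟨fun π hπ π' hπ' => ⟨hlattice.supClosed hπ hπ', hlattice.infClosed hπ hπ'⟩,
    M.isLeast_replicaGain θ ρ, M.isGreatest_removalLoss θ ρ⟩
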